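/- Let $D>1$ be a square-free integer, $K=\mathbb{Q}(\sqrt D)\subset\mathbb{R}$ (with $\sqrt D>0$), $\mathcal{O}_K$ its ring of integers, $a\mapsto\overline a$ Galois conjugation, and $\varepsilon>1$ the fundamental unit of $\mathcal{O}_K$, so that $\mathcal{O}_K^\times=\pm\varepsilon^{\mathbb Z}$. Identify $V_K=K\otimes_{\mathbb Q}\mathbb R$ with $\mathbb{R}^2$ by $a\otimes 1\mapsto(\overline a,a)$, write $\mathbf N(s,u)=|su|$, and let $\mathbb T_K=V_K/\mathcal{O}_K$, with the automorphism $\phi$ induced by multiplication by $\varepsilon$. For $P\in V_K$ put $M(P)=\inf_{Q\in\mathcal{O}_K}\mathbf N(P-Q)$; this descends to $\mathbb T_K$, and for $t\in\mathbb R$ we put $X_t=\{P\in\mathbb T_K: M(P)\ge t\}$. Let $\alpha=\frac{1+\sqrt D}{2}$ if $D\equiv1\pmod 4$ and $\alpha=\sqrt D$ otherwise, and let $R_0,R_1\subset\mathbb T_K$ be the images of the open planar rectangles $(0,-\overline{\alpha})\times(0,1)$ and $(-1,0)\times(0,\alpha)$; the union of these two planar rectangles is called the footprint. If $D=5$ let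 $\mathcal P_0=\{R_0,R_1\}$; otherwise let $\mathcal P_0$ be the set of connected components of the sets $A_0\cap\phi^{-1}(A_1)$ with $A_0,A_1\in\{R_0,R_1\}$. For $n\ge0$ let $\mathcal P_n$ be the set of all nonempty intersections $A=\bigcap_{i=-n}^{n}\phi^{-i}(A_i)$ with $A_i\in\mathcal P_0$; $A_{-n}\cdots A_n$ is the coordinate word of $A$. Let $\Sigma\subset\mathcal P_0^{\mathbb Z}$ be the set of strings $s$ with $s_i\cap\phi^{-1}(s_{i+1})\ne\emptyset$ for all $i\in\mathbb{Z}$, and let $\pi:\Sigma\to\mathbb T_K$ be the coding map sending $s$ to the unique point of $\bigcap_{n\ge0}\overline{\bigcap_{i=-n}^{n}\phi^{-i}(s_i)}$. For a collection $\mathcal C\subset\mathcal P_n$ let $\Sigma\langle\mathcal C\rangle$ be the set of $s\in\Sigma$ in which no coordinate word of a member of $\mathcal C$ occurs. For a finite set $I\subset\mathcal{O}_K$ and $t\in\mathbb R$ let $\mathcal U(t,I)=\bigcup_{Q\in I}\{P\in V_K:\mathbf N(P-Q)<t\}$, and let $\mathcal T_n(t,I)$ be the set of $A\in\mathcal P_n$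 such that the closure of the planar representative of $A$ contained in the footprint is a subset of $\mathcal U(t,I)$. Then there is a finite set $I_K\subset\mathcal{O}_K$ such that for every finite set $I$ with $I_K\subseteq I\subset\mathcal{O}_K$ the following hold. For all real $t'<t$ there is $n_0$ such that for all $n\ge n_0$ $$\pi^{-1}(X_t)\subseteq\Sigma\langle\mathcal T_n(t,I)\rangle\subseteq\pi^{-1}(X_{t'}).$$ In particular, for every $t\in\mathbb{R}$, $$\pi^{-1}(X_t)=\bigcap_{n\ge0}\Sigma\langle\mathcal T_n(t,I)\rangle.$$ -/

import Mathlib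

open Set Filter Topology

noncomputable section

namespace RealQuadraticTorus

/-! ### The field, its ring of integers and the plane -/

/-- The quadratic algebra `ℚ[ω]/(ω² - D)`, that is the field `K = ℚ(√D)` when `D` is not a square.
Elements are pairs `⟨re, im⟩`, standing for `re + im √D`. -/
abbrev K (D : ℕ) : Type := QuadraticAlgebra ℚ (D : ℚ) 0

/-- The ring of integers `𝒪_K`: the integral closure of `ℤ` in `K`. -/
abbrev OK (D : ℕ) : Subalgebra ℤ (K D) := integralClosure ℤ (K D)

/-- The plane `V_K = K ⊗ ℝ`, in the (stable, unstable) coordinates `(s, u)`. -/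
abbrev V : Type := ℝ × ℝ

/-- The canonical map `K → V_K`, `a ↦ (conjugate of a, a)`. -/
def embed (D : ℕ) : K D →+* V where
  toFun a := ((a.re : ℝ) - a.im * √D, (a.re : ℝ) + a.im * √D)
  map_one' := by simp [Prod.ext_iff, QuadraticAlgebra.re_one, QuadraticAlgebra.im_one]
  map_zero' := by simp
  map_add' a b := by
    ext <;> simp <;> ring
  map_mul' a b := by
    have h : √(D : ℝ) * √(D : ℝ) = D := Real.mul_self_sqrt (Nat.cast_nonneg D)
    ext <;> simp <;> linear_combination (-(a.im : ℝ) * b.im) * h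

/-- The absolute norm `𝐍(s, u) = |s u|` on `V_K`. -/
def absNorm (P : V) : ℝ := |P.1 * P.2|

/-- The lattice `𝒪_K ⊆ V_K`. -/
def lattice (D : ℕ) : AddSubgroup V :=
  (OK D).toSubring.toAddSubgroup.map (embed D : K D →+ V)

/-- The torus `𝕋_K = V_K / 𝒪_K`, with the quotient topology. -/
abbrev Torus (D : ℕ) : Type := V ⧸ lattice D

/-- The projection `V_K → 𝕋_K`. -/
def proj (D : ℕ) (P : V) : Torus D := (P : V ⧸ lattice D)

/-! ### The Euclidean minimum function and the sets `X_t` -/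

/-- `M(P) = inf_{Q ∈ 𝒪_K} 𝐍(P - Q)` for a point `P` of the plane. -/
def planeM (D : ℕ) (P : V) : ℝ := ⨅ Q : OK D, absNorm (P - embed D Q)

lemma planeM_eq_of_sub_mem (D : ℕ) {P P' : V} (h : -P + P' ∈ lattice D) :
    planeM D P = planeM D P' := by
  obtain ⟨q, hq, hqe⟩ := h
  have hqe' : embed D q = -P + P' := hqe
  unfold planeM
  refine Equiv.iInf_congr (Equiv.addRight (⟨q, hq⟩ : OK D)) fun Q => ?_
  have : P' - embed D ((Q + (⟨q, hq⟩ : OK D) : OK D) : K D) = P - embed D Q := by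
    rw [Subalgebra.coe_add, map_add, hqe']
    abel
  simpa using congrArg absNorm this

/-- The function `M` on the torus. -/
def M (D : ℕ) (P : Torus D) : ℝ :=
  Quotient.liftOn' P (planeM D) fun _ _ h =>
    planeM_eq_of_sub_mem D (QuotientAddGroup.leftRel_apply.mp h)

/-- `X_t = {P ∈ 𝕋_K | M(P) ≥ t}`. -/
def X (D : ℕ) (t : ℝ) : Set (Torus D) := {P | t ≤ M D P}

/-! ### The fundamental unit and the automorphism `φ` -/

/-- `ε` is the fundamental unit of `𝒪_K` with `ε > 1`: every unit is `± ε ^ k`. -/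
def IsFundamentalUnit (D : ℕ) (ε : (OK D)ˣ) : Prop :=
  1 < (embed D ((ε : OK D) : K D)).2 ∧ ∀ v : (OK D)ˣ, ∃ k : ℤ, v = ε ^ k ∨ v = -ε ^ k

/-- Multiplication by a unit, on the torus. -/
def unitMul (D : ℕ) (v : (OK D)ˣ) : Torus D →+ Torus D :=
  QuotientAddGroup.map (lattice D) (lattice D)
    (AddMonoidHom.mulLeft (embed D ((v : OK D) : K D))) (by
      rintro _ ⟨q, hq, rfl⟩
      exact ⟨((v : OK D) : K D) * q, (OK D).mul_mem (v : OK D).2 hq, map_mul (embed D) _ _⟩)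

lemma unitMul_mul_apply (D : ℕ) (v w : (OK D)ˣ) (h : v * w = 1) (P : Torus D) :
    unitMul D v (unitMul D w P) = P := by
  induction P using QuotientAddGroup.induction_on with
  | H P =>
    change ((embed D ((v : OK D) : K D) * (embed D ((w : OK D) : K D) * P) : V) : V ⧸ lattice D) = _
    have h1 : ((v : OK D) : K D) * ((w : OK D) : K D) = 1 := by
      have := congrArg (fun x : (OK D)ˣ => ((x : OK D) : K D)) h
      simpa using this
    rw [← mul_assoc, ← map_mul, h1, map_one, one_mul]

/-- The automorphism `φ` of `𝕋_K` induced by multiplication by `ε`. -/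
def phi (D : ℕ) (ε : (OK D)ˣ) : Equiv.Perm (Torus D) where
  toFun := unitMul D ε
  invFun := unitMul D ε⁻¹
  left_inv := unitMul_mul_apply D ε⁻¹ ε (inv_mul_cancel ε)
  right_inv := unitMul_mul_apply D ε ε⁻¹ (mul_inv_cancel ε)

/-! ### The Markov generator `𝒫₀` and its refinements -/

/-- `α_K`: the element `(1 + √D)/2` if `D ≡ 1 mod 4`, and `√D` otherwise. -/
def alpha (D : ℕ) : K D := if D % 4 = 1 then ⟨1 / 2, 1 / 2⟩ else ⟨0, 1⟩

/-- The open planar rectangle with corners `(0, 0)`, `(-conj α_K, 0)` and `(0, 1)`. -/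
def planeR₀ (D : ℕ) : Set V := Ioo 0 (-(embed D (alpha D)).1) ×ˢ Ioo 0 1

/-- The open planar rectangle with corners `(0, 0)`, `(-1, 0)` and `(0, α_K)`. -/
def planeR₁ (D : ℕ) : Set V := Ioo (-1) 0 ×ˢ Ioo 0 (embed D (alpha D)).2

/-- The two-rectangle Markov partition `{R₀, R₁}` of the torus. -/
def twoRect (D : ℕ) : Set (Set (Torus D)) := {proj D '' planeR₀ D, proj D '' planeR₁ D}

/-- The Markov generator `𝒫₀`: the partition `{R₀, R₁}` itself for `ℚ(√5)`, and for every other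
field the connected components of the intersections `A₀ ∩ φ⁻¹(A₁)` with `A₀, A₁ ∈ {R₀, R₁}`. -/
def P₀ (D : ℕ) (ε : (OK D)ˣ) : Set (Set (Torus D)) :=
  if D = 5 then twoRect D
  else {C | ∃ A₀ ∈ twoRect D, ∃ A₁ ∈ twoRect D, ∃ x ∈ A₀ ∩ phi D ε ⁻¹' A₁,
    C = connectedComponentIn (A₀ ∩ phi D ε ⁻¹' A₁) x}

/-- The alphabet: the members of `𝒫₀`. -/
abbrev Letter (D : ℕ) (ε : (OK D)ˣ) : Type := {A : Set (Torus D) // A ∈ P₀ D ε}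

/-- Words `A_{-n} ⋯ A_0 ⋯ A_n` in the alphabet `𝒫₀`. -/
abbrev Word (D : ℕ) (ε : (OK D)ˣ) (n : ℕ) : Type := Icc (-(n : ℤ)) (n : ℤ) → Letter D ε

/-- The intersection `φⁿ(A_{-n}) ∩ ⋯ ∩ A_0 ∩ ⋯ ∩ φ⁻ⁿ(A_n)`. -/
def wordSet {D : ℕ} {ε : (OK D)ˣ} {n : ℕ} (w : Word D ε n) : Set (Torus D) :=
  ⋂ i : Icc (-(n : ℤ)) (n : ℤ), (phi D ε ^ (i : ℤ)) ⁻¹' (w i : Set (Torus D))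

/-- The refinement `𝒫_n`: all nonempty sets `wordSet w`. -/
def P (D : ℕ) (ε : (OK D)ˣ) (n : ℕ) : Set (Set (Torus D)) :=
  {A | A.Nonempty ∧ ∃ w : Word D ε n, A = wordSet w}

/-- The planar representative of `A`, contained in the footprint `R₀ ∪ R₁`. -/
def planeRep (D : ℕ) (A : Set (Torus D)) : Set V :=
  proj D ⁻¹' A ∩ (planeR₀ D ∪ planeR₁ D)

/-! ### The symbolic coding -/

/-- `Σ`: the admissible bi-infinite strings, `AB` being admissible if `A ∩ φ⁻¹(B) ≠ ∅`. -/
def Sigma (D : ℕ) (ε : (OK D)ˣ) : Set (ℤ → Letter D ε) :=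
  {s | ∀ i : ℤ, ((s i : Set (Torus D)) ∩ phi D ε ⁻¹' (s (i + 1) : Set (Torus D))).Nonempty}

/-- The word of length `2n + 1` of the string `s` centred at `k`. -/
def window {D : ℕ} {ε : (OK D)ˣ} (s : ℤ → Letter D ε) (k : ℤ) (n : ℕ) : Word D ε n :=
  fun i => s (k + i)

/-- `π(s) = p`: the intersection over `n` of the closures of
`φⁿ(s_{-n}) ∩ ⋯ ∩ s_0 ∩ ⋯ ∩ φ⁻ⁿ(s_n)` is the single point `p`. -/
def IsCoded {D : ℕ} {ε : (OK D)ˣ} (s : ℤ → Letter D ε) (p : Torus D) : Prop :=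
  ⋂ n : ℕ, closure (wordSet (window s 0 n)) = {p}

/-- `π⁻¹(Y)`: the strings `s ∈ Σ` with `π(s) ∈ Y`. -/
def piPreimage (D : ℕ) (ε : (OK D)ˣ) (Y : Set (Torus D)) : Set (ℤ → Letter D ε) :=
  {s | s ∈ Sigma D ε ∧ ∃ p ∈ Y, IsCoded s p}

/-- `Σ⟨C⟩` for a collection `C` of members of `𝒫_n`: the strings in `Σ` in which no coordinate
word of a member of `C` occurs. -/
def sigmaAvoid (D : ℕ) (ε : (OK D)ˣ) (n : ℕ) (C : Set (Set (Torus D))) :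
    Set (ℤ → Letter D ε) :=
  {s | s ∈ Sigma D ε ∧ ∀ w : Word D ε n, wordSet w ∈ C → ∀ k : ℤ, window s k n ≠ w}

/-! ### Trapped rectangles -/

/-- `𝒰(t, I)`: the points of the plane at norm-distance less than `t` from a point of `I`. -/
def U (D : ℕ) (t : ℝ) (I : Finset (OK D)) : Set V :=
  ⋃ Q ∈ I, {P : V | absNorm (P - embed D Q) < t}

/-- `𝒯_n(t, I)`: the members of `𝒫_n` whose closure (in the plane) is contained in `𝒰(t, I)`. -/
def T (D : ℕ) (ε : (OK D)ˣ) (n : ℕ) (t : ℝ) (I : Finset (OK D)) : Set (Set (Torus D)) :=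
  {A | A ∈ P D ε n ∧ closure (planeRep D A) ⊆ U D t I}

end RealQuadraticTorus

end

/-! `M` is invariant under `φ`, since multiplication by a unit permutes the lattice and preserves
`𝐍`. If a trapped word occurs in `s` at position `k`, then `φ^k (π s)` has a lift in `𝒰(t, I)`, so
`M (π s) < t`. This gives the first inclusion, for every `n` and `I`
(`piPreimage_subset_sigmaAvoid`).

Conversely let `M p < t'` with `p = π s`, witnessed by `𝐍(P₀ - Q) < t'`. Multiplying by a suitable
`ε^k` keeps the norm and balances the two coordinates, so that both are bounded in terms of `K`
alone. Translating `ε^k P₀` back to the closed footprint replaces `Q` by an integer of bounded size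
(`exists_bounded_witness`). There are finitely many such integers, and they form `I_K`. On bounded
differences `𝐍` is uniformly continuous and cylinders shrink exponentially, so for `n` large in
terms of `t - t'` the whole cylinder at position `k` lies in `𝒰(t, I)`: its word is trapped
(`sigmaAvoid_subset_piPreimage`).

Strings in `Σ` are constrained only at adjacent letters, so nonempty and small cylinders, and with
them the existence of `π`, rest on the Markov property (`markov_step`,
`cylinder_nonempty_and_small`). Its source is that no lattice translate of the segments carrying the
sides of the rectangles enters the footprint, while `ε` contracts the stable segment into itself and
`ε⁻¹` the unstable one. -/

namespace RealQuadraticTorus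

/-! ### Arithmetic of the lattice -/

/-- The real number `α`. -/
noncomputable def al (D : ℕ) : ℝ := (embed D (alpha D)).2

/-- The real number `-conj α`. -/
noncomputable def be (D : ℕ) : ℝ := -(embed D (alpha D)).1

/-- The conjugate of an integral element is integral, so trace and norm are rational and integral
over `ℤ`, hence integers. -/
lemma exists_trace_norm_int {D : ℕ} {x : K D} (hx : x ∈ OK D) :
    (∃ m : ℤ, (m : ℚ) = 2 * x.re) ∧ ∃ k : ℤ, (k : ℚ) = x.re ^ 2 - D * x.im ^ 2 := by
  have hx : IsIntegral ℤ x := hx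
  have hs : IsIntegral ℤ (star x) := by
    have := hx.map ((starRingEnd (K D)).toIntAlgHom)
    simpa [starRingEnd_apply] using this
  have key : ∀ r : ℚ, IsIntegral ℤ (algebraMap ℚ (K D) r) → ∃ m : ℤ, (m : ℚ) = r := by
    intro r h
    rw [isIntegral_algebraMap_iff QuadraticAlgebra.algebraMap_injective] at h
    obtain ⟨m, hm⟩ := IsIntegrallyClosed.isIntegral_iff.1 h
    exact ⟨m, by simpa using hm⟩
  constructor
  · apply key
    have h := hx.add hs
    rw [← QuadraticAlgebra.algebraMap_trace_eq_add_star] at h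
    simpa [QuadraticAlgebra.trace_def] using h
  · apply key
    have h := hx.mul hs
    rw [← QuadraticAlgebra.algebraMap_norm_eq_mul_star] at h
    convert h using 2
    rw [QuadraticAlgebra.norm_def]
    ring

/-- The squared denominator of `q` is coprime to the squared numerator, so it divides the
square-free `D`. -/
lemma exists_int_of_sq_mul {D : ℕ} (hsq : Squarefree D) {q : ℚ} {k : ℤ}
    (h : (D : ℚ) * q ^ 2 = k) : ∃ n : ℤ, (n : ℚ) = q := by
  have hq : (q.den : ℤ) * q.den ∣ D := by
    have h1 : (D : ℤ) * q.num ^ 2 = k * q.den ^ 2 := by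
      have hd : (q.den : ℚ) ≠ 0 := by exact_mod_cast q.den_nz
      have hn : (q.num : ℚ) = q * q.den := (Rat.mul_den_eq_num q).symm
      have : (D : ℚ) * (q.num : ℚ) ^ 2 = k * (q.den : ℚ) ^ 2 := by
        rw [hn, ← h]; ring
      exact_mod_cast this
    have hc : IsCoprime ((q.den : ℤ) * q.den) (q.num ^ 2) := by
      have : IsCoprime (q.den : ℤ) q.num :=
        (Int.isCoprime_iff_gcd_eq_one.2 (by simpa [Int.gcd] using q.reduced)).symm
      rw [← sq]
      exact this.pow
    refine hc.dvd_of_dvd_mul_right ⟨k, ?_⟩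
    rw [h1]; ring
  have hq' : q.den * q.den ∣ D := by exact_mod_cast hq
  have : q.den = 1 := by simpa using hsq _ hq'
  exact ⟨q.num, (Rat.den_eq_one_iff q).1 this⟩

/-- With `m`, `n` twice the coordinates, integrality of the norm reads `m² - D n² = 4k`. Squares mod
4 force `m ≡ n` mod 2 if `D ≡ 1`, and both even if `D ≡ 2, 3`. -/
lemma OK_repr {D : ℕ} (hsq : Squarefree D) {x : K D} (hx : x ∈ OK D) :
    ∃ m n : ℤ, x = m + n * alpha D := by
  obtain ⟨⟨m, hm⟩, k, hk⟩ := exists_trace_norm_int hx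
  obtain ⟨n, hn⟩ := exists_int_of_sq_mul hsq (q := 2 * x.im) (k := m ^ 2 - 4 * k) (by
    push_cast; rw [hm, hk]; ring)
  have hre : x.re = m / 2 := by rw [hm]; ring
  have him : x.im = n / 2 := by rw [hn]; ring
  have hkey : m ^ 2 - D * n ^ 2 = 4 * k := by
    rw [hre, him] at hk
    have : ((m ^ 2 - D * n ^ 2 : ℤ) : ℚ) = (4 * k : ℤ) := by push_cast; rw [hk]; ring
    exact_mod_cast this
  have h4 : D % 4 ≠ 0 := fun h0 => by
    have : 2 * 2 ∣ D := by omega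
    simpa using hsq 2 this
  have hparity : D % 4 = 1 ∧ (2 : ℤ) ∣ m - n ∨ D % 4 ≠ 1 ∧ (2 : ℤ) ∣ m ∧ (2 : ℤ) ∣ n := by
    obtain ⟨j, r, hj, hr⟩ : ∃ j r : ℤ, (D : ℤ) = 4 * j + r ∧ r = ((D % 4 : ℕ) : ℤ) :=
      ⟨(D / 4 : ℕ), (D % 4 : ℕ), by push_cast; omega, rfl⟩
    have hr' : m ^ 2 - r * n ^ 2 = 4 * (k + j * n ^ 2) := by
      rw [hj] at hkey; linear_combination hkey
    generalize k + j * n ^ 2 = l at hr'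
    have hD : D % 4 < 4 := Nat.mod_lt _ (by norm_num)
    rcases Int.even_or_odd' m with ⟨a, rfl | rfl⟩ <;> rcases Int.even_or_odd' n with ⟨b, rfl | rfl⟩ <;>
      generalize D % 4 = d at * <;> interval_cases d <;> simp only [Nat.cast_ofNat, Nat.cast_one, Nat.cast_zero] at hr <;>
      subst hr <;> ring_nf at hr' <;> omega
  unfold alpha
  rcases hparity with ⟨h1, a, ha⟩ | ⟨h1, ⟨a, ha⟩, b, hb⟩
  · refine ⟨a, n, ?_⟩
    rw [if_pos h1]
    have : (m : ℚ) = 2 * a + n := by exact_mod_cast (by linarith : m = 2 * a + n)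
    ext
    · simp [hre, this]; ring
    · simp [him]; ring
  · refine ⟨a, b, ?_⟩
    rw [if_neg h1]
    ext
    · simp [hre, ha]
    · simp [him, hb]

lemma alpha_mem (D : ℕ) : alpha D ∈ OK D := by
  change IsIntegral ℤ _
  unfold alpha
  split_ifs with h
  · obtain ⟨j, hj⟩ : ∃ j : ℕ, D = 4 * j + 1 := ⟨D / 4, by omega⟩
    refine ⟨Polynomial.X ^ 2 - Polynomial.X - Polynomial.C (j : ℤ), ?_, ?_⟩
    · monicity!
    · ext <;> simp [sq] <;> (try rw [hj]) <;> (try push_cast) <;> ring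
  · refine ⟨Polynomial.X ^ 2 - Polynomial.C (D : ℤ), ?_, ?_⟩
    · monicity!
    · ext <;> simp [sq]

lemma lattice_repr {D : ℕ} (hsq : Squarefree D) {c : V} (hc : c ∈ lattice D) :
    ∃ m n : ℤ, c.1 = m - n * be D ∧ c.2 = m + n * al D := by
  obtain ⟨x, hx, rfl⟩ := hc
  obtain ⟨m, n, rfl⟩ := OK_repr hsq hx
  refine ⟨m, n, ?_, ?_⟩
  · change (embed D _).1 = _
    simp [map_add, map_mul, be]
  · change (embed D _).2 = _
    simp [map_add, map_mul, al]

lemma embed_mem_lattice {D : ℕ} {x : K D} (hx : x ∈ OK D) : embed D x ∈ lattice D :=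
  ⟨x, hx, rfl⟩

lemma alpha_mem_lattice (D : ℕ) : ((-be D, al D) : V) ∈ lattice D := by
  have := embed_mem_lattice (alpha_mem D)
  simpa [be, al] using this

lemma one_mem_lattice (D : ℕ) : ((1, 1) : V) ∈ lattice D := by
  have := embed_mem_lattice (OK D).one_mem
  rwa [map_one] at this

/-- `α > 1`, `-conj α > 0` and `|N(α)| ≥ 1`, with `conj α` and `α` roots of an integral quadratic. -/
lemma al_be {D : ℕ} (hD : 1 < D) :
    1 < al D ∧ 0 < be D ∧ 1 ≤ al D * be D ∧ be D ≤ al D ∧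
      ∃ p q : ℤ, al D - be D = p ∧ al D * be D = q := by
  have hs : √(D : ℝ) * √(D : ℝ) = D := Real.mul_self_sqrt (Nat.cast_nonneg D)
  have h0 : 0 ≤ √(D : ℝ) := Real.sqrt_nonneg _
  have hD' : (2 : ℝ) ≤ D := by exact_mod_cast hD
  unfold al be embed alpha
  split_ifs with h
  · obtain ⟨j, hj⟩ : ∃ j : ℕ, D = 4 * j + 1 := ⟨D / 4, by omega⟩
    have hj1 : (1 : ℝ) ≤ j := by
      have : 1 ≤ j := by omega
      exact_mod_cast this
    have hDj : (D : ℝ) = 4 * j + 1 := by rw [hj]; push_cast; ring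
    have h2 : 1 < √(D : ℝ) := by nlinarith
    simp only [RingHom.coe_mk, MonoidHom.coe_mk, OneHom.coe_mk]
    push_cast
    refine ⟨by linarith, by linarith, by nlinarith, by linarith, 1, j, by push_cast; ring, ?_⟩
    push_cast
    nlinarith
  · have h2 : 1 < √(D : ℝ) := by nlinarith
    simp only [RingHom.coe_mk, MonoidHom.coe_mk, OneHom.coe_mk]
    push_cast
    refine ⟨by linarith, by linarith, by nlinarith, by linarith, 0, D, by push_cast; ring, ?_⟩
    push_cast
    nlinarith

lemma isInt_norm_of_mem {D : ℕ} (hD : 1 < D) (hsq : Squarefree D) {c : V} (hc : c ∈ lattice D) :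
    ∃ k : ℤ, c.1 * c.2 = k := by
  obtain ⟨m, n, h1, h2⟩ := lattice_repr hsq hc
  obtain ⟨-, -, -, -, p, q, hp, hq⟩ := al_be hD
  refine ⟨m ^ 2 + m * n * p - n ^ 2 * q, ?_⟩
  push_cast
  rw [h1, h2, ← hp, ← hq]
  ring

lemma al_be_five : al 5 = be 5 + 1 ∧ al 5 * be 5 = 1 := by
  have hs : √(5 : ℝ) * √(5 : ℝ) = 5 := Real.mul_self_sqrt (by norm_num)
  simp only [al, be, embed, alpha]
  norm_num
  constructor <;> nlinarith

/-! ### The unit -/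

/-- The image of the unit in the plane. -/
noncomputable def unitPt {D : ℕ} (ε : (OK D)ˣ) : V := embed D ((ε : OK D) : K D)

lemma unitPt_mul {D : ℕ} (v w : (OK D)ˣ) : unitPt (v * w) = unitPt v * unitPt w := by
  simp [unitPt]

lemma unitPt_one {D : ℕ} : unitPt (1 : (OK D)ˣ) = 1 := by
  simp [unitPt]

lemma unitPt_mem_lattice {D : ℕ} (v : (OK D)ˣ) : unitPt v ∈ lattice D :=
  embed_mem_lattice (v : OK D).2

lemma unitPt_mul_mem_lattice {D : ℕ} (v : (OK D)ˣ) {c : V} (hc : c ∈ lattice D) :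
    unitPt v * c ∈ lattice D := by
  obtain ⟨x, hx, rfl⟩ := hc
  exact ⟨((v : OK D) : K D) * x, (OK D).mul_mem (v : OK D).2 hx, map_mul (embed D) _ _⟩

lemma unitPt_inv_mul {D : ℕ} (v : (OK D)ˣ) (P : V) : unitPt v⁻¹ * (unitPt v * P) = P := by
  rw [← mul_assoc, ← unitPt_mul, inv_mul_cancel, unitPt_one, one_mul]

/-- The norms of `v` and `v⁻¹` are integers with product `1`. -/
lemma abs_norm_unitPt {D : ℕ} (hD : 1 < D) (hsq : Squarefree D) (v : (OK D)ˣ) :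
    |(unitPt v).1 * (unitPt v).2| = 1 := by
  obtain ⟨k, hk⟩ := isInt_norm_of_mem hD hsq (unitPt_mem_lattice v)
  obtain ⟨l, hl⟩ := isInt_norm_of_mem hD hsq (unitPt_mem_lattice v⁻¹)
  have h : unitPt v * unitPt v⁻¹ = 1 := by rw [← unitPt_mul, mul_inv_cancel, unitPt_one]
  have h1 : (unitPt v).1 * (unitPt v⁻¹).1 = 1 := congrArg Prod.fst h
  have h2 : (unitPt v).2 * (unitPt v⁻¹).2 = 1 := congrArg Prod.snd h
  have hkl : k * l = 1 := by
    have : (k : ℝ) * l = 1 := by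
      rw [← hk, ← hl]; linear_combination (unitPt v).2 * (unitPt v⁻¹).2 * h1 + h2
    exact_mod_cast this
  rw [hk]
  rcases Int.eq_one_or_neg_one_of_mul_eq_one hkl with rfl | rfl <;> simp

lemma absNorm_unitPt_mul {D : ℕ} (hD : 1 < D) (hsq : Squarefree D) (v : (OK D)ˣ) (P : V) :
    absNorm (unitPt v * P) = absNorm P := by
  unfold absNorm
  rw [Prod.fst_mul, Prod.snd_mul, mul_mul_mul_comm, abs_mul, abs_norm_unitPt hD hsq, one_mul]

lemma abs_fst_unitPt {D : ℕ} (hD : 1 < D) (hsq : Squarefree D) {ε : (OK D)ˣ}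
    (h : 1 < (unitPt ε).2) : |(unitPt ε).1| = ((unitPt ε).2)⁻¹ := by
  have := abs_norm_unitPt hD hsq ε
  rw [abs_mul, abs_of_pos (by linarith : 0 < (unitPt ε).2)] at this
  exact eq_inv_of_mul_eq_one_left this

/-- A unit larger than `1` with negative norm is at least `α`. -/
lemma al_le_unit {D : ℕ} (hD : 1 < D) (hsq : Squarefree D) {ε : (OK D)ˣ}
    (h : 1 < (unitPt ε).2) (h1 : (unitPt ε).1 < 0) : al D ≤ (unitPt ε).2 := by
  obtain ⟨m, n, hm, hn⟩ := lattice_repr hsq (unitPt_mem_lattice ε)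
  obtain ⟨ha, hb, hab, -⟩ := al_be hD
  have hu := abs_norm_unitPt hD hsq ε
  rw [abs_of_neg (by nlinarith)] at hu
  set x := (unitPt ε).1
  set y := (unitPt ε).2
  have hd : y - x = n * (al D + be D) := by rw [hm, hn]; ring
  have hn1 : (1 : ℝ) ≤ n := by
    have : (0 : ℝ) < n := by
      by_contra hc
      nlinarith
    exact_mod_cast this
  have hs : al D + be D ≤ y - x := by nlinarith
  -- Since `x = -1/y`, `hs` says `y + 1/y ≥ α + be D ≥ α + 1/α`. This contradicts `1 < y < α`, as `z
  -- + 1/z` increases for `z > 1`; the products below clear denominators.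
  by_contra hc
  push Not at hc
  have hx : -x * y = 1 := by linarith
  have hay : 1 < al D * y := by nlinarith
  have e1 := mul_le_mul_of_nonneg_right hs (by linarith : 0 ≤ al D * y)
  have e2 : (y - x) * (al D * y) = al D * y ^ 2 + al D := by linear_combination al D * hx
  have e3 := mul_le_mul_of_nonneg_right hab (by linarith : 0 ≤ y)
  have e4 := mul_pos (by linarith : 0 < al D - y) (by linarith : 0 < al D * y - 1)
  nlinarith

/-- The fundamental unit of `ℚ(√5)` is at most `α`. -/
lemma unit_le_al_five {ε : (OK 5)ˣ} (hε : IsFundamentalUnit 5 ε) : (unitPt ε).2 ≤ al 5 := by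
  -- For `D = 5` this makes `α` itself a unit, hence plus or minus a power of `ε`; sign and size
  -- leave only `ε ^ n` with `n ≥ 1`.
  have hmul : alpha 5 * (alpha 5 - 1) = 1 := by
    ext <;> simp [alpha, QuadraticAlgebra.re_one, QuadraticAlgebra.im_one] <;> norm_num
  let a : (OK 5)ˣ := Units.mkOfMulEqOne ⟨alpha 5, alpha_mem 5⟩
    ⟨alpha 5 - 1, (OK 5).sub_mem (alpha_mem 5) (OK 5).one_mem⟩ (Subtype.ext hmul)
  have ha : (unitPt a).2 = al 5 := rfl
  have h1 : 1 < (unitPt ε).2 := hε.1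
  have hal : 1 < al 5 := (al_be (by norm_num)).1
  have hpow : ∀ n : ℕ, (unitPt (ε ^ n)).2 = (unitPt ε).2 ^ n := by
    intro n
    simp [unitPt]
  have hinv : ∀ v : (OK 5)ˣ, (unitPt v).2 * (unitPt v⁻¹).2 = 1 := fun v => by
    have : unitPt v * unitPt v⁻¹ = 1 := by rw [← unitPt_mul, mul_inv_cancel, unitPt_one]
    exact congrArg Prod.snd this
  have hneg : ∀ v : (OK 5)ˣ, (unitPt (-v)).2 = -(unitPt v).2 := fun v => by simp [unitPt]
  have hp : ∀ n : ℕ, 1 ≤ (unitPt (ε ^ n)).2 := fun n => by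
    rw [hpow]; exact one_le_pow₀ h1.le
  obtain ⟨k, hk⟩ := hε.2 a
  obtain ⟨n, rfl | rfl⟩ := k.eq_nat_or_neg
  · rw [zpow_natCast] at hk
    rcases hk with hk | hk
    · rw [← ha, hk, hpow]
      rcases Nat.eq_zero_or_pos n with rfl | hn
      · rw [hk, hpow, pow_zero] at ha; linarith
      · exact le_self_pow₀ h1.le hn.ne'
    · rw [hk, hneg] at ha
      linarith [hp n]
  · rw [zpow_neg, zpow_natCast] at hk
    have h2 := hinv (ε ^ n)
    have h3 := hp n
    have h4 : 0 < (unitPt (ε ^ n)⁻¹).2 := by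
      by_contra hc
      nlinarith
    rcases hk with hk | hk
    · rw [hk] at ha
      nlinarith
    · rw [hk, hneg] at ha
      linarith

/-! ### The footprint -/

/-- Left ends of the stable sides of the two base rectangles. -/
noncomputable def lo : Bool → ℝ
  | false => 0
  | true => -1

/-- Right ends of the stable sides of the two base rectangles. -/
noncomputable def hi (D : ℕ) : Bool → ℝ
  | false => be D
  | true => 0

/-- Upper ends of the unstable sides of the two base rectangles. -/
noncomputable def top (D : ℕ) : Bool → ℝ
  | false => 1
  | true => al D

/-- The two base rectangles. -/
def base (D : ℕ) (b : Bool) : Set V := Ioo (lo b) (hi D b) ×ˢ Ioo 0 (top D b)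

lemma base_false (D : ℕ) : base D false = planeR₀ D := rfl

lemma base_true (D : ℕ) : base D true = planeR₁ D := rfl

lemma mem_base {D : ℕ} {b : Bool} {P : V} :
    P ∈ base D b ↔ (lo b < P.1 ∧ P.1 < hi D b) ∧ 0 < P.2 ∧ P.2 < top D b := Iff.rfl

/-- The footprint. -/
def footprint (D : ℕ) : Set V := planeR₀ D ∪ planeR₁ D

lemma mem_footprint {D : ℕ} {P : V} : P ∈ footprint D ↔ ∃ b, P ∈ base D b := by
  rw [Bool.exists_bool]; rfl

lemma base_subset_footprint (D : ℕ) (b : Bool) : base D b ⊆ footprint D :=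
  fun _ h => mem_footprint.2 ⟨b, h⟩

lemma twoRect_eq (D : ℕ) : twoRect D = range fun b => proj D '' base D b := by
  ext A
  simp only [twoRect, mem_insert_iff, mem_singleton_iff, mem_range, Bool.exists_bool, base_false,
    base_true, eq_comm]

lemma int_not_between {m : ℤ} (k : ℤ) (h1 : (k : ℝ) < m) (h2 : (m : ℝ) < k + 1) : False := by
  have h1' : k < m := by exact_mod_cast h1
  have h2' : m < k + 1 := by exact_mod_cast h2
  omega

lemma int_lt_of_mul_lt {n k : ℤ} {x : ℝ} (hx : 0 < x) (h : (n : ℝ) * x < k * x) : n < k := by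
  exact_mod_cast lt_of_mul_lt_mul_right h hx.le

lemma base_index_unique {D : ℕ} {a b : Bool} {P : V} (ha : P ∈ base D a) (hb : P ∈ base D b) :
    a = b := by
  rw [mem_base] at ha hb
  cases a <;> cases b <;> simp only [lo, hi] at ha hb <;> first | rfl | (exfalso; linarith)

/-- The two coordinates of `m + nα` differ by `n (α + be D)`, so the sizes of the rectangles force
`|n| < 2`; then `n = ±1` would put `m` strictly between consecutive integers. -/
lemma base_translate {D : ℕ} (hD : 1 < D) (hsq : Squarefree D) {a b : Bool} {P Q : V}
    (ha : P ∈ base D a) (hb : Q ∈ base D b) (h : Q - P ∈ lattice D) : P = Q := by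
  obtain ⟨m, n, h1, h2⟩ := lattice_repr hsq h
  obtain ⟨hal, hbe, hab, -⟩ := al_be hD
  wlog hle : a ≤ b generalizing a b P Q m n
  · refine (this hb ha ?_ (-m) (-n) ?_ ?_ (le_of_not_ge hle)).symm
    · rw [← neg_sub]; exact neg_mem h
    · rw [← neg_sub, Prod.fst_neg, h1]; push_cast; ring
    · rw [← neg_sub, Prod.snd_neg, h2]; push_cast; ring
  rw [mem_base] at ha hb
  rw [Prod.fst_sub] at h1
  rw [Prod.snd_sub] at h2
  have hpos : 0 < al D + be D := by linarith
  have hn2 : n < 2 := int_lt_of_mul_lt hpos (by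
    push_cast
    cases a <;> cases b <;> simp only [lo, hi, top] at ha hb <;> linarith)
  have hn2' : -2 < n := int_lt_of_mul_lt hpos (by
    push_cast
    cases a <;> cases b <;> simp only [lo, hi, top] at ha hb <;> linarith)
  have hm : n = 0 ∧ m = 0 := by
    obtain rfl | rfl | rfl : n = -1 ∨ n = 0 ∨ n = 1 := by omega
    · refine (int_not_between (m := m) 0 ?_ ?_).elim <;> push_cast at h1 h2 ⊢ <;>
        cases a <;> cases b <;> simp only [lo, hi, top] at ha hb <;> linarith
    · refine ⟨rfl, ?_⟩
      have h3 : (m : ℝ) < 1 := by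
        cases a <;> cases b <;> simp only [lo, hi, top] at ha hb <;> push_cast at h1 h2 <;> linarith
      have h4 : (-1 : ℝ) < m := by
        cases a <;> cases b <;> simp only [lo, hi, top] at ha hb <;> push_cast at h1 h2 <;> linarith
      have h3' : m < 1 := by exact_mod_cast h3
      have h4' : -1 < m := by exact_mod_cast h4
      omega
    · refine (int_not_between (m := m) (-1) ?_ ?_).elim <;> push_cast at h1 h2 ⊢ <;>
        cases a <;> cases b <;> simp only [lo, hi, top] at ha hb <;> linarith
  obtain ⟨rfl, rfl⟩ := hm
  push_cast at h1 h2
  ext <;> linarith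

/-- No lattice translate of the unstable segment `{0} × [0, 1 + α]` meets the footprint. -/
lemma unstable_segment_disjoint {D : ℕ} (hD : 1 < D) (hsq : Squarefree D) {b : Bool} {w : ℝ}
    (hw0 : 0 ≤ w) (hw1 : w ≤ 1 + al D) {c : V} (hc : c ∈ lattice D) :
    ((0, w) : V) + c ∉ base D b := by
  intro hb
  obtain ⟨m, n, h1, h2⟩ := lattice_repr hsq hc
  obtain ⟨hal, hbe, hab, -⟩ := al_be hD
  rw [mem_base, Prod.fst_add, Prod.snd_add, h1, h2] at hb
  dsimp only at hb
  have hpos : 0 < al D + be D := by linarith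
  have hn2 : n < 2 := int_lt_of_mul_lt hpos (by
    push_cast
    cases b <;> simp only [lo, hi, top] at hb <;> linarith)
  have hn2' : -2 < n := int_lt_of_mul_lt hpos (by
    push_cast
    cases b <;> simp only [lo, hi, top] at hb <;> linarith)
  obtain rfl | rfl | rfl : n = -1 ∨ n = 0 ∨ n = 1 := by omega
  · refine int_not_between (m := m) (-1) ?_ ?_ <;> push_cast at hb ⊢ <;>
      cases b <;> simp only [lo, hi, top] at hb <;> linarith
  · cases b
    · refine int_not_between (m := m) 0 ?_ ?_ <;> push_cast at hb ⊢ <;>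
        simp only [lo, hi, top] at hb <;> linarith
    · refine int_not_between (m := m) (-1) ?_ ?_ <;> push_cast at hb ⊢ <;>
        simp only [lo, hi, top] at hb <;> linarith
  · refine int_not_between (m := m) (-1) ?_ ?_ <;> push_cast at hb ⊢ <;>
      cases b <;> simp only [lo, hi, top] at hb <;> linarith

/-- No lattice translate of the stable segment `[-1, -conj α] × {0}` meets the footprint. -/
lemma stable_segment_disjoint {D : ℕ} (hD : 1 < D) (hsq : Squarefree D) {b : Bool} {j : ℝ}
    (hj0 : -1 ≤ j) (hj1 : j ≤ be D) {c : V} (hc : c ∈ lattice D) :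
    ((j, 0) : V) + c ∉ base D b := by
  intro hb
  obtain ⟨m, n, h1, h2⟩ := lattice_repr hsq hc
  obtain ⟨hal, hbe, hab, -⟩ := al_be hD
  rw [mem_base, Prod.fst_add, Prod.snd_add, h1, h2] at hb
  dsimp only at hb
  have hpos : 0 < al D + be D := by linarith
  have hn2 : n < 2 := int_lt_of_mul_lt hpos (by
    push_cast
    cases b <;> simp only [lo, hi, top] at hb <;> linarith)
  have hn2' : -2 < n := int_lt_of_mul_lt hpos (by
    push_cast
    cases b <;> simp only [lo, hi, top] at hb <;> linarith)
  obtain rfl | rfl | rfl : n = -1 ∨ n = 0 ∨ n = 1 := by omega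
  · refine int_not_between (m := m) 0 ?_ ?_ <;> push_cast at hb ⊢ <;>
      cases b <;> simp only [lo, hi, top] at hb <;> linarith
  · refine int_not_between (m := m) 0 ?_ ?_ <;> push_cast at hb ⊢ <;>
        cases b <;> simp only [lo, hi, top] at hb <;> linarith
  · refine int_not_between (m := m) (-1) ?_ ?_ <;> push_cast at hb ⊢ <;>
      cases b <;> simp only [lo, hi, top] at hb <;> linarith

/-- Modulo the lattice all vertical sides lie on one segment: adding `α` moves the outer side of
`R₀` onto it, adding `1` that of `R₁`. -/
lemma vertical_side {D : ℕ} (hD : 1 < D) {b : Bool} {x y : ℝ} (hx : x = lo b ∨ x = hi D b)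
    (hy0 : 0 < y) (hy1 : y < top D b) :
    ∃ w, 0 ≤ w ∧ w ≤ 1 + al D ∧ ∃ c ∈ lattice D, ((x, y) : V) = (0, w) + c := by
  obtain ⟨hal, -⟩ := al_be hD
  cases b <;> simp only [lo, hi, top] at hx hy1 <;> rcases hx with rfl | rfl
  · exact ⟨y, by linarith, by linarith, 0, zero_mem _, by simp⟩
  · refine ⟨y + al D, by linarith, by linarith, _, neg_mem (alpha_mem_lattice D), by simp⟩
  · exact ⟨y + 1, by linarith, by linarith, _, neg_mem (one_mem_lattice D), by simp⟩
  · exact ⟨y, by linarith, by linarith, 0, zero_mem _, by simp⟩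

/-- Subtracting `1` brings the top of `R₀` down to the base line, and subtracting `α` the top of
`R₁`. -/
lemma horizontal_side {D : ℕ} (hD : 1 < D) {b : Bool} {x y : ℝ} (hy : y = 0 ∨ y = top D b)
    (hx0 : lo b < x) (hx1 : x < hi D b) :
    ∃ j, -1 ≤ j ∧ j ≤ be D ∧ ∃ c ∈ lattice D, ((x, y) : V) = (j, 0) + c := by
  obtain ⟨-, hbe, -⟩ := al_be hD
  cases b <;> simp only [lo, hi, top] at hx0 hx1 hy <;> rcases hy with rfl | rfl
  · exact ⟨x, by linarith, by linarith, 0, zero_mem _, by simp⟩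
  · exact ⟨x - 1, by linarith, by linarith, _, one_mem_lattice D, by simp⟩
  · exact ⟨x, by linarith, by linarith, 0, zero_mem _, by simp⟩
  · exact ⟨x + be D, by linarith, by linarith, _, alpha_mem_lattice D, by simp⟩

/-! ### Markov crossings -/

/-- The first half of the Markov property: images of stable sides lie in stable sides. -/
lemma stable_crossing {D : ℕ} (hD : 1 < D) (hsq : Squarefree D) {ε : (OK D)ˣ}
    (hε : 1 < (unitPt ε).2) {a b : Bool} {c P X : V} (hc : c ∈ lattice D) (hP : P ∈ base D a)
    (hPb : unitPt ε * P - c ∈ base D b) (hX : X ∈ base D a) :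
    lo b < (unitPt ε).1 * X.1 - c.1 ∧ (unitPt ε).1 * X.1 - c.1 < hi D b := by
  by_contra hcon
  set f : ℝ → ℝ := fun z => (unitPt ε).1 * z - c.1 with hf
  have hfc : ContinuousOn f (uIcc P.1 X.1) := by fun_prop
  have hsub : uIcc P.1 X.1 ⊆ Ioo (lo a) (hi D a) :=
    ordConnected_Ioo.uIcc_subset hP.1 hX.1
  have hPb' := mem_base.1 hPb
  rw [Prod.fst_sub, Prod.fst_mul] at hPb'
  -- Otherwise the image of the horizontal segment towards `X` reaches a vertical side of `base D
  -- b`. Pulled back by `ε⁻¹`, that side lies in a translate of the excluded unstable segment, yet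
  -- meets `base D a`.
  obtain ⟨z, hz, hfz⟩ : ∃ z ∈ uIcc P.1 X.1, f z = lo b ∨ f z = hi D b := by
    rcases not_and_or.1 hcon with h | h <;> push Not at h
    · obtain ⟨z, hz, hfz⟩ := intermediate_value_uIcc hfc
        (mem_uIcc.2 (Or.inr ⟨h, hPb'.1.1.le⟩))
      exact ⟨z, hz, Or.inl hfz⟩
    · obtain ⟨z, hz, hfz⟩ := intermediate_value_uIcc hfc
        (mem_uIcc.2 (Or.inl ⟨hPb'.1.2.le, h⟩))
      exact ⟨z, hz, Or.inr hfz⟩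
  obtain ⟨w, hw0, hw1, d, hd, he⟩ := vertical_side hD hfz hPb'.2.1 hPb'.2.2
  have hmem : ((z, P.2) : V) ∈ base D a := ⟨hsub hz, hP.2⟩
  have heq : ((z, P.2) : V) = (0, w / (unitPt ε).2) + unitPt ε⁻¹ * (d + c) := by
    have h1 : unitPt ε * (z, P.2) = (0, w) + (d + c) := by
      rw [← add_assoc, ← he]
      ext <;> simp [hf]
    have h2 : ((0, w) : V) = unitPt ε * (0, w / (unitPt ε).2) := by
      ext
      · simp
      · simp only [Prod.snd_mul]; field_simp
    rw [← unitPt_inv_mul ε (z, P.2), h1, mul_add, h2, unitPt_inv_mul]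
  rw [heq] at hmem
  refine unstable_segment_disjoint hD hsq (by positivity) ?_
    (unitPt_mul_mem_lattice ε⁻¹ (add_mem hd hc)) hmem
  exact (div_le_self hw0 hε.le).trans hw1

/-- For positive `conj ε` contraction suffices. A negative one reflects the segment, and then `ε ≥
α` is needed: it gives `|conj ε| ≤ 1/α ≤ be D` and `|conj ε| * be D ≤ 1`. -/
lemma unit_mul_stable {D : ℕ} (hD : 1 < D) (hsq : Squarefree D) {ε : (OK D)ˣ}
    (hε : 1 < (unitPt ε).2) {j : ℝ} (hj0 : -1 ≤ j) (hj1 : j ≤ be D) :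
    -1 ≤ (unitPt ε).1 * j ∧ (unitPt ε).1 * j ≤ be D := by
  have habs := abs_fst_unitPt hD hsq hε
  have hinv : ((unitPt ε).2)⁻¹ < 1 := inv_lt_one_of_one_lt₀ hε
  obtain ⟨hal, hbe, hab, hba, -⟩ := al_be hD
  rcases le_or_gt 0 (unitPt ε).1 with h | h
  · rw [abs_of_nonneg h] at habs
    constructor <;> nlinarith
  · have hle := al_le_unit hD hsq hε h
    rw [abs_of_neg h] at habs
    set x := (unitPt ε).1
    set y := (unitPt ε).2
    have hxy : -x * y = 1 := by rw [habs]; field_simp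
    have h1 : -x * al D ≤ 1 := by nlinarith
    have h2 : -x ≤ be D := by nlinarith
    have h3 : -x * be D ≤ 1 := by nlinarith
    constructor <;> nlinarith

/-- The second half of the Markov property: unstable sides lie in images of unstable sides. -/
lemma unstable_crossing {D : ℕ} (hD : 1 < D) (hsq : Squarefree D) {ε : (OK D)ˣ}
    (hε : 1 < (unitPt ε).2) {a b : Bool} {c P Y : V} (hc : c ∈ lattice D) (hP : P ∈ base D a)
    (hPb : unitPt ε * P - c ∈ base D b) (hY : Y ∈ base D b) :
    0 < (Y.2 + c.2) / (unitPt ε).2 ∧ (Y.2 + c.2) / (unitPt ε).2 < top D a := by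
  by_contra hcon
  set f : ℝ → ℝ := fun y => (y + c.2) / (unitPt ε).2 with hf
  set y₀ := (unitPt ε * P - c).2 with hy₀
  have hfc : ContinuousOn f (uIcc y₀ Y.2) := by fun_prop
  have hsub : uIcc y₀ Y.2 ⊆ Ioo 0 (top D b) :=
    ordConnected_Ioo.uIcc_subset hPb.2 hY.2
  have hP' := mem_base.1 hP
  have hfy : f y₀ = P.2 := by
    simp only [hf, hy₀, Prod.snd_sub, Prod.snd_mul]
    field_simp
    ring
  -- Dually, the vertical segment towards `Y` would meet the image of a horizontal side of `base D
  -- a`, which by `unit_mul_stable` lies in a translate of the excluded stable segment.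
  obtain ⟨y, hy, hfy⟩ : ∃ y ∈ uIcc y₀ Y.2, f y = 0 ∨ f y = top D a := by
    rcases not_and_or.1 hcon with h | h <;> push Not at h
    · obtain ⟨z, hz, hfz⟩ := intermediate_value_uIcc hfc
        (mem_uIcc.2 (Or.inr ⟨h, by rw [hfy]; exact hP'.2.1.le⟩))
      exact ⟨z, hz, Or.inl hfz⟩
    · obtain ⟨z, hz, hfz⟩ := intermediate_value_uIcc hfc
        (mem_uIcc.2 (Or.inl ⟨by rw [hfy]; exact hP'.2.2.le, h⟩))
      exact ⟨z, hz, Or.inr hfz⟩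
  obtain ⟨j, hj0, hj1, d, hd, he⟩ := horizontal_side hD hfy hP'.1.1 hP'.1.2
  have hmem : (((unitPt ε * P - c).1, y) : V) ∈ base D b := ⟨hPb.1, hsub hy⟩
  have heq : (((unitPt ε * P - c).1, y) : V) =
      ((unitPt ε).1 * j, 0) + (unitPt ε * d - c) := by
    have h1 : (((unitPt ε * P - c).1, y) : V) = unitPt ε * (P.1, f y) - c := by
      ext
      · simp
      · simp only [hf, Prod.snd_sub, Prod.snd_mul]; field_simp; ring
    rw [h1, he]
    ext <;> simp
    ring
  rw [heq] at hmem
  obtain ⟨h0, h1⟩ := unit_mul_stable hD hsq hε hj0 hj1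
  exact stable_segment_disjoint hD hsq h0 h1
    (sub_mem (unitPt_mul_mem_lattice ε hd) hc) hmem

lemma shift_interval_subset {t c r : ℝ} (ht : 0 < t)
    (h : ∀ y, 0 < y → y < t → 0 < y + c ∧ y + c < r) : 0 ≤ c ∧ c + t ≤ r := by
  constructor
  · by_contra! hc
    have h1 := h (min (t / 2) (-c / 2)) (lt_min (by linarith) (by linarith))
      ((min_le_left _ _).trans_lt (by linarith))
    linarith [min_le_right (t / 2) (-c / 2)]
  · by_contra! hc
    have h1 := h (max (t / 2) (r - c)) (lt_max_of_lt_left (by linarith))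
      (max_lt (by linarith) (by linarith))
    linarith [le_max_right (t / 2) (r - c)]

/-- For `ℚ(√5)` the image of a base rectangle meets each other rectangle at most once. -/
lemma crossing_unique_five {ε : (OK 5)ˣ} (hε : IsFundamentalUnit 5 ε) {a b : Bool}
    {c c' P P' : V} (hc : c ∈ lattice 5) (hc' : c' ∈ lattice 5) (hP : P ∈ base 5 a)
    (hPb : unitPt ε * P - c ∈ base 5 b) (hP' : P' ∈ base 5 a)
    (hPb' : unitPt ε * P' - c' ∈ base 5 b) : c' = c := by
  have hD : 1 < 5 := by norm_num
  have hsq : Squarefree 5 := (by norm_num : Nat.Prime 5).squarefree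
  have h1 : 1 < (unitPt ε).2 := hε.1
  have hle := unit_le_al_five hε
  obtain ⟨hal, hbe, -⟩ := al_be hD
  obtain ⟨hab, hab'⟩ := al_be_five
  have htop : ∀ b, 0 < top 5 b := by
    intro b; cases b <;> simp only [top] <;> linarith
  -- `base 5 b` shifted up by `c.2` fits into the image of `base 5 a`, whose height is at most `α *
  -- top 5 a` because `ε ≤ α`.
  have hu : ∀ {c P : V}, c ∈ lattice 5 → P ∈ base 5 a → unitPt ε * P - c ∈ base 5 b →
      0 ≤ c.2 ∧ c.2 + top 5 b ≤ al 5 * top 5 a := by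
    intro c P hc hP hPb
    refine shift_interval_subset (htop b) fun y hy0 hy1 => ?_
    have hY : (((unitPt ε * P - c).1, y) : V) ∈ base 5 b := ⟨hPb.1, hy0, hy1⟩
    obtain ⟨h2, h3⟩ := unstable_crossing hD hsq h1 hc hP hPb hY
    have h4 : 0 < (unitPt ε).2 := by linarith
    rw [div_lt_iff₀ h4] at h3
    rw [lt_div_iff₀ h4, zero_mul] at h2
    exact ⟨h2, h3.trans_le (by nlinarith [htop a])⟩
  have hu1 := hu hc hP hPb
  have hu2 := hu hc' hP' hPb'
  have hs1 := stable_crossing hD hsq h1 hc hP hPb hP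
  -- Taken at the same `P` as `hs1`, so `c` and `c'` differ in stable coordinate by less than the
  -- width of `base 5 b`.
  have hs2 := stable_crossing hD hsq h1 hc' hP' hPb' hP
  obtain ⟨m, n, hm, hn⟩ := lattice_repr hsq (sub_mem hc' hc)
  rw [Prod.fst_sub] at hm
  rw [Prod.snd_sub] at hn
  have hpos : 0 < al 5 + be 5 := by linarith
  have hbe1 : be 5 < 1 := by nlinarith
  have hbe2 : 1 < 2 * be 5 := by nlinarith
  have hsq' : al 5 * al 5 = al 5 + 1 := by nlinarith
  have hn0 : n < 1 := int_lt_of_mul_lt hpos (by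
    push_cast
    cases a <;> cases b <;> simp only [lo, hi, top] at hs1 hs2 hu1 hu2 <;> linarith)
  have hn1 : -1 < n := int_lt_of_mul_lt hpos (by
    push_cast
    cases a <;> cases b <;> simp only [lo, hi, top] at hs1 hs2 hu1 hu2 <;> linarith)
  obtain rfl : n = 0 := by omega
  push_cast at hm hn
  have hm0 : (m : ℝ) < 1 := by cases b <;> simp only [lo, hi] at hs1 hs2 <;> linarith
  have hm1 : (-1 : ℝ) < m := by cases b <;> simp only [lo, hi] at hs1 hs2 <;> linarith
  have hm0' : m < 1 := by exact_mod_cast hm0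
  have hm1' : -1 < m := by exact_mod_cast hm1
  obtain rfl : m = 0 := by omega
  push_cast at hm hn
  ext <;> linarith

/-! ### The torus -/

lemma proj_eq_proj {D : ℕ} {P Q : V} : proj D P = proj D Q ↔ Q - P ∈ lattice D := by
  rw [proj, proj, QuotientAddGroup.eq, neg_add_eq_sub]

lemma proj_sub {D : ℕ} {P c : V} (hc : c ∈ lattice D) : proj D (P - c) = proj D P := by
  rw [proj_eq_proj, sub_sub_cancel]; exact hc

lemma exists_proj_eq {D : ℕ} (p : Torus D) : ∃ P, proj D P = p :=
  QuotientAddGroup.mk_surjective p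

lemma continuous_proj (D : ℕ) : Continuous (proj D) := continuous_quotient_mk'

lemma isOpenMap_proj (D : ℕ) : IsOpenMap (proj D) := QuotientAddGroup.isOpenMap_coe

lemma phi_proj {D : ℕ} (ε : (OK D)ˣ) (P : V) : phi D ε (proj D P) = proj D (unitPt ε * P) := rfl

lemma footprint_translate {D : ℕ} (hD : 1 < D) (hsq : Squarefree D) {P Q : V}
    (hP : P ∈ footprint D) (hQ : Q ∈ footprint D) (h : proj D P = proj D Q) : P = Q := by
  obtain ⟨a, ha⟩ := mem_footprint.1 hP
  obtain ⟨b, hb⟩ := mem_footprint.1 hQ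
  exact base_translate hD hsq ha hb (proj_eq_proj.1 h)

lemma planeRep_image {D : ℕ} (hD : 1 < D) (hsq : Squarefree D) {S : Set V}
    (hS : S ⊆ footprint D) : planeRep D (proj D '' S) = S := by
  ext P
  constructor
  · rintro ⟨⟨Q, hQ, hQP⟩, hP⟩
    rwa [← footprint_translate hD hsq (hS hQ) hP hQP]
  · exact fun h => ⟨mem_image_of_mem _ h, hS h⟩

lemma isOpen_base (D : ℕ) (b : Bool) : IsOpen (base D b) := isOpen_Ioo.prod isOpen_Ioo

lemma convex_base (D : ℕ) (b : Bool) : Convex ℝ (base D b) := (convex_Ioo _ _).prod (convex_Ioo _ _)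

lemma base_nonempty {D : ℕ} (hD : 1 < D) (b : Bool) : (base D b).Nonempty := by
  obtain ⟨hal, hbe, -⟩ := al_be hD
  cases b
  · exact ⟨(be D / 2, 1 / 2), by simp only [mem_base, lo, hi, top]; constructor <;> constructor <;> linarith⟩
  · exact ⟨(-1 / 2, 1 / 2), by simp only [mem_base, lo, hi, top]; constructor <;> constructor <;> linarith⟩

/-! ### The letters as rectangles -/

/-- The part of a base rectangle mapped into a given translate of another one. -/
def strip {D : ℕ} (ε : (OK D)ˣ) (a b : Bool) (c : V) : Set V :=
  {P | P ∈ base D a ∧ unitPt ε * P - c ∈ base D b}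

lemma strip_subset {D : ℕ} (ε : (OK D)ˣ) (a b : Bool) (c : V) : strip ε a b c ⊆ footprint D :=
  fun _ h => base_subset_footprint D a h.1

lemma isOpen_strip {D : ℕ} (ε : (OK D)ˣ) (a b : Bool) (c : V) : IsOpen (strip ε a b c) :=
  (isOpen_base D a).inter ((isOpen_base D b).preimage (by fun_prop))

lemma convex_strip {D : ℕ} (ε : (OK D)ˣ) (a b : Bool) (c : V) : Convex ℝ (strip ε a b c) := by
  refine (convex_base D a).inter fun P hP Q hQ s t hs ht hst => ?_
  have := convex_base D b hP hQ hs ht hst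
  have hs' : s = 1 - t := by linarith
  subst hs'
  have he : unitPt ε * ((1 - t) • P + t • Q) - c =
      (1 - t) • (unitPt ε * P - c) + t • (unitPt ε * Q - c) := by
    ext <;> simp <;> ring
  change unitPt ε * ((1 - t) • P + t • Q) - c ∈ base D b
  rwa [he]

/-- A member of an open disjoint cover containing `x` is the connected component of `x`. -/
lemma connectedComponentIn_eq_of_open_cover {X ι : Type*} [TopologicalSpace X] {F : Set X}
    {u : ι → Set X} (hF : F = ⋃ i, u i) (ho : ∀ i, IsOpen (u i)) (hc : ∀ i, IsPreconnected (u i))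
    {i : ι} (hd : ∀ j, (u i ∩ u j).Nonempty → u j = u i) {x : X} (hx : x ∈ u i) :
    connectedComponentIn F x = u i := by
  have hi : u i ⊆ F := hF ▸ subset_iUnion u i
  refine Subset.antisymm ?_ ((hc i).subset_connectedComponentIn hx hi)
  refine isPreconnected_connectedComponentIn.subset_left_of_subset_union (ho i)
    (isOpen_iUnion fun j : {j // u j ≠ u i} => ho j) ?_ ?_ ⟨x, mem_connectedComponentIn (hi hx), hx⟩
  · rw [disjoint_iUnion_right]
    rintro ⟨j, hj⟩
    rw [disjoint_iff_inter_eq_empty, ← not_nonempty_iff_eq_empty]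
    exact fun h => hj (hd j h)
  · refine (connectedComponentIn_subset F x).trans ?_
    rw [hF]
    refine iUnion_subset fun j => ?_
    by_cases h : u j = u i
    · rw [h]; exact subset_union_left
    · exact (subset_iUnion (fun j : {j // u j ≠ u i} => u j) ⟨j, h⟩).trans subset_union_right

lemma strip_image_cover {D : ℕ} (ε : (OK D)ˣ) (a b : Bool) :
    proj D '' base D a ∩ phi D ε ⁻¹' (proj D '' base D b) =
      ⋃ c : lattice D, proj D '' strip ε a b c := by
  ext p
  simp only [mem_inter_iff, mem_preimage, mem_iUnion]
  constructor
  · rintro ⟨⟨P, hP, rfl⟩, Q, hQ, hQP⟩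
    rw [phi_proj, proj_eq_proj] at hQP
    exact ⟨⟨_, hQP⟩, P, ⟨hP, by simpa using hQ⟩, rfl⟩
  · rintro ⟨⟨c, hc⟩, P, hP, rfl⟩
    exact ⟨⟨P, hP.1, rfl⟩, _, hP.2, by rw [proj_sub hc, phi_proj]⟩

/-- The strips are open and convex, and their images coincide or are disjoint: `base_translate`
identifies the lifts of a common point, and applied once more to their translated images it
identifies the shifts. -/
lemma component_eq_strip {D : ℕ} (hD : 1 < D) (hsq : Squarefree D) (ε : (OK D)ˣ) (a b : Bool)
    {x : Torus D} (hx : x ∈ proj D '' base D a ∩ phi D ε ⁻¹' (proj D '' base D b)) :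
    ∃ c ∈ lattice D, (strip ε a b c).Nonempty ∧
      connectedComponentIn (proj D '' base D a ∩ phi D ε ⁻¹' (proj D '' base D b)) x =
        proj D '' strip ε a b c := by
  have hcov := strip_image_cover ε a b
  obtain ⟨c, hxc⟩ := mem_iUnion.1 (hcov ▸ hx)
  refine ⟨c, c.2, Set.image_nonempty.1 ⟨x, hxc⟩, ?_⟩
  refine connectedComponentIn_eq_of_open_cover hcov
    (fun c => isOpenMap_proj D _ (isOpen_strip ε a b c))
    (fun c => (convex_strip ε a b c).isPreconnected.image _ (continuous_proj D).continuousOn)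
    ?_ hxc
  rintro d ⟨_, ⟨P, hP, rfl⟩, Q, hQ, hQP⟩
  obtain rfl := base_translate hD hsq hQ.1 hP.1 (proj_eq_proj.1 hQP)
  have h := base_translate hD hsq hP.2 hQ.2 (by
    rw [sub_sub_sub_cancel_left]; exact sub_mem c.2 d.2)
  rw [sub_right_inj] at h
  rw [h]

/-- Letters become explicit planar rectangles. For `D ≠ 5` a letter also records one shift `c`,
valid at all its points. -/
lemma letter_cases {D : ℕ} (hD : 1 < D) (hsq : Squarefree D) {ε : (OK D)ˣ} (A : Letter D ε) :
    (D = 5 ∧ ∃ a, (A : Set (Torus D)) = proj D '' base D a ∧ planeRep D A = base D a) ∨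
      (D ≠ 5 ∧ ∃ a b, ∃ c ∈ lattice D, (strip ε a b c).Nonempty ∧
        (A : Set (Torus D)) = proj D '' strip ε a b c ∧ planeRep D A = strip ε a b c) := by
  obtain ⟨A, hA⟩ := A
  unfold P₀ at hA
  split_ifs at hA with h
  · rw [twoRect_eq] at hA
    obtain ⟨a, rfl⟩ := hA
    exact Or.inl ⟨h, a, rfl, planeRep_image hD hsq (base_subset_footprint D a)⟩
  · rw [twoRect_eq] at hA
    obtain ⟨_, ⟨a, rfl⟩, _, ⟨b, rfl⟩, x, hx, rfl⟩ := hA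
    obtain ⟨c, hc, hne, he⟩ := component_eq_strip hD hsq ε a b hx
    exact Or.inr ⟨h, a, b, c, hc, hne, he, 
      (congrArg (planeRep D) he).trans (planeRep_image hD hsq (strip_subset ε a b c))⟩

lemma base_prod {D : ℕ} {a : Bool} {P Q : V} (hP : P ∈ base D a) (hQ : Q ∈ base D a) :
    ((P.1, Q.2) : V) ∈ base D a := ⟨hP.1, hQ.2⟩

lemma planeRep_prod {D : ℕ} (hD : 1 < D) (hsq : Squarefree D) {ε : (OK D)ˣ} (A : Letter D ε)
    {P Q : V} (hP : P ∈ planeRep D A) (hQ : Q ∈ planeRep D A) :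
    ((P.1, Q.2) : V) ∈ planeRep D A := by
  rcases letter_cases hD hsq A with ⟨-, a, -, h⟩ | ⟨-, a, b, c, -, -, -, h⟩
  · rw [h] at hP hQ ⊢
    exact base_prod hP hQ
  · rw [h] at hP hQ ⊢
    exact ⟨base_prod hP.1 hQ.1, base_prod hP.2 hQ.2⟩

lemma planeRep_nonempty {D : ℕ} (hD : 1 < D) (hsq : Squarefree D) {ε : (OK D)ˣ}
    (A : Letter D ε) : (planeRep D A).Nonempty := by
  rcases letter_cases hD hsq A with ⟨-, a, -, h⟩ | ⟨-, a, b, c, -, hne, -, h⟩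
  · rw [h]
    exact base_nonempty hD a
  · rwa [h]

lemma exists_planeRep {D : ℕ} (hD : 1 < D) (hsq : Squarefree D) {ε : (OK D)ˣ}
    (A : Letter D ε) {p : Torus D} (hp : p ∈ (A : Set (Torus D))) :
    ∃ P ∈ planeRep D A, proj D P = p := by
  rcases letter_cases hD hsq A with ⟨-, a, hA, h⟩ | ⟨-, a, b, c, -, -, hA, h⟩ <;>
  · rw [h]
    rwa [hA] at hp

/-- The Markov property of the partition into letters. -/
lemma markov_step {D : ℕ} (hD : 1 < D) (hsq : Squarefree D) {ε : (OK D)ˣ}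
    (hε : IsFundamentalUnit D ε) (A B : Letter D ε)
    (h : ((A : Set (Torus D)) ∩ phi D ε ⁻¹' (B : Set (Torus D))).Nonempty) :
    ∃ c ∈ lattice D,
      (∀ P ∈ planeRep D A, phi D ε (proj D P) ∈ (B : Set (Torus D)) →
        unitPt ε * P - c ∈ planeRep D B) ∧
      ∀ P ∈ planeRep D A, ∀ Q ∈ planeRep D B,
        (((unitPt ε).1 * P.1 - c.1, Q.2) : V) ∈ planeRep D B ∧
        ((P.1, (Q.2 + c.2) / (unitPt ε).2) : V) ∈ planeRep D A := by
  have hu : 1 < (unitPt ε).2 := hε.1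
  obtain ⟨p, hpA, hpB⟩ := h
  obtain ⟨P₀, hP₀, rfl⟩ := exists_planeRep hD hsq A hpA
  rw [mem_preimage] at hpB
  rcases letter_cases hD hsq A with ⟨h5, a, -, hA⟩ | ⟨h5, a, b, c, hc, -, -, hA⟩
  · obtain ⟨b, hB, hB'⟩ := ((letter_cases hD hsq B).resolve_right fun h => h.1 h5).2
    rw [hA] at hP₀
    rw [hB] at hpB
    rw [hA, hB', hB]
    have hlift : ∀ P ∈ base D a, phi D ε (proj D P) ∈ proj D '' base D b →
        ∃ c ∈ lattice D, unitPt ε * P - c ∈ base D b := by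
      rintro P hP ⟨Q, hQ, hQP⟩
      rw [phi_proj, proj_eq_proj] at hQP
      exact ⟨_, hQP, by simpa using hQ⟩
    obtain ⟨c, hc, hcb⟩ := hlift P₀ hP₀ hpB
    refine ⟨c, hc, fun P hP hPB => ?_, fun P hP Q hQ => ⟨?_, ?_⟩⟩
    -- The shift could depend on `P`; `crossing_unique_five` excludes this.
    · obtain ⟨c', hc', hcb'⟩ := hlift P hP hPB
      subst h5
      rwa [← crossing_unique_five hε hc hc' hP₀ hcb hP hcb']
    · exact ⟨stable_crossing hD hsq hu hc hP₀ hcb hP, hQ.2⟩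
    · exact ⟨hP.1, unstable_crossing hD hsq hu hc hP₀ hcb hQ⟩
  · have hstep : ∀ P ∈ planeRep D A, phi D ε (proj D P) ∈ (B : Set (Torus D)) →
        unitPt ε * P - c ∈ planeRep D B := by
      intro P hP hPB
      rw [hA] at hP
      refine ⟨?_, base_subset_footprint D b hP.2⟩
      rwa [mem_preimage, proj_sub hc, ← phi_proj]
    refine ⟨c, hc, hstep, ?_⟩
    have hQ₀ := hstep P₀ hP₀ hpB
    obtain ⟨a', b', c', hc', -, -, hB⟩ :=
      ((letter_cases hD hsq B).resolve_left fun h => h5 h.1).2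
    rw [hA] at hP₀ ⊢
    rw [hB] at hQ₀ ⊢
    -- The rectangle into which `A` is mapped is the one containing `B`.
    obtain rfl := base_index_unique hP₀.2 hQ₀.1
    intro P hP Q hQ
    have hmem : (((unitPt ε).1 * P.1 - c.1, Q.2) : V) ∈ base D b := base_prod hP.2 hQ.1
    refine ⟨⟨hmem, ?_⟩, ⟨hP.1.1, unstable_crossing hD hsq hu hc hP₀.1 hP₀.2 hQ.1⟩, ?_⟩
    · exact ⟨stable_crossing hD hsq hu hc' hQ.1 hQ.2 hmem, hQ.2.2⟩
    · convert hmem using 1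
      ext
      · simp
      · simp only [Prod.snd_sub, Prod.snd_mul]; field_simp; ring

/-! ### Iterates of the automorphism -/

lemma phi_mul {D : ℕ} (v w : (OK D)ˣ) : phi D (v * w) = phi D v * phi D w := by
  ext p
  obtain ⟨P, rfl⟩ := exists_proj_eq p
  rw [Equiv.Perm.mul_apply, phi_proj, phi_proj, phi_proj, unitPt_mul, mul_assoc]

lemma phi_zpow {D : ℕ} (ε : (OK D)ˣ) (k : ℤ) : phi D ε ^ k = phi D (ε ^ k) :=
  (map_zpow (MonoidHom.mk' (phi D) phi_mul) ε k).symm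

lemma phi_zpow_proj {D : ℕ} (ε : (OK D)ˣ) (k : ℤ) (P : V) :
    (phi D ε ^ k) (proj D P) = proj D (unitPt (ε ^ k) * P) := by
  rw [phi_zpow, phi_proj]

lemma continuous_phi {D : ℕ} (v : (OK D)ˣ) : Continuous (phi D v) := by
  refine (QuotientAddGroup.isQuotientMap_mk (N := lattice D)).continuous_iff.2 ?_
  have : Continuous fun P : V => proj D (unitPt v * P) :=
    (continuous_proj D).comp (by fun_prop)
  exact this

/-! ### Discreteness of the lattice -/

lemma lattice_eq_zero_of_small {D : ℕ} (hD : 1 < D) (hsq : Squarefree D) {c : V}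
    (hc : c ∈ lattice D) (h : ‖c‖ < 1 / 2) : c = 0 := by
  obtain ⟨m, n, h1, h2⟩ := lattice_repr hsq hc
  obtain ⟨hal, hbe, -⟩ := al_be hD
  have h3 := abs_lt.1 ((norm_fst_le c).trans_lt h)
  have h4 := abs_lt.1 ((norm_snd_le c).trans_lt h)
  have hpos : 0 < al D + be D := by linarith
  have hn1 : n < 1 := int_lt_of_mul_lt hpos (by push_cast; linarith)
  have hn2 : -1 < n := int_lt_of_mul_lt hpos (by push_cast; linarith)
  obtain rfl : n = 0 := by omega
  push_cast at h1 h2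
  have hm1 : m < 1 := by
    have : (m : ℝ) < 1 := by linarith
    exact_mod_cast this
  have hm2 : -1 < m := by
    have : (-1 : ℝ) < m := by linarith
    exact_mod_cast this
  obtain rfl : m = 0 := by omega
  push_cast at h1 h2
  ext
  · rw [h1]; simp
  · rw [h2]; simp

lemma isClosed_lattice {D : ℕ} (hD : 1 < D) (hsq : Squarefree D) :
    IsClosed (lattice D : Set V) := by
  have : DiscreteTopology (lattice D) := by
    refine discreteTopology_of_isOpen_singleton_zero ?_
    have h : ({0} : Set (lattice D)) = (fun c : lattice D => (c : V)) ⁻¹' Metric.ball 0 (1 / 2) := by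
      ext c
      simp only [mem_singleton_iff, mem_preimage, mem_ball_zero_iff]
      constructor
      · rintro rfl
        simp
      · exact fun h => Subtype.ext (lattice_eq_zero_of_small hD hsq c.2 h)
    rw [h]
    exact Metric.isOpen_ball.preimage continuous_subtype_val
  exact AddSubgroup.isClosed_of_discrete

lemma t2Space_torus {D : ℕ} (hD : 1 < D) (hsq : Squarefree D) : T2Space (Torus D) := by
  have := isClosed_lattice hD hsq
  infer_instance

/-- The source of the finiteness of `I_K`. -/
lemma finite_bounded_integers {D : ℕ} (hD : 1 < D) (hsq : Squarefree D) (R : ℝ) :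
    {Q : OK D | ‖embed D Q‖ ≤ R}.Finite := by
  obtain ⟨hal, hbe, -⟩ := al_be hD
  obtain ⟨N, hN⟩ := exists_nat_gt (2 * R)
  obtain ⟨N', hN'⟩ := exists_nat_gt (R + N * al D)
  refine (((finite_Icc (-(N' : ℤ)) N').prod (finite_Icc (-(N : ℤ)) N)).image
    fun p : ℤ × ℤ => (p.1 + p.2 * ⟨alpha D, alpha_mem D⟩ : OK D)).subset ?_
  rintro ⟨x, hx⟩ hR
  obtain ⟨m, n, hmn⟩ := OK_repr hsq hx
  have h1 : (embed D x).1 = m - n * be D := by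
    rw [hmn]; simp [map_add, map_mul, be]
  have h2 : (embed D x).2 = m + n * al D := by
    rw [hmn]; simp [map_add, map_mul, al]
  have hR : ‖embed D x‖ ≤ R := hR
  have h3 := abs_le.1 ((norm_fst_le _).trans hR)
  have h4 := abs_le.1 ((norm_snd_le _).trans hR)
  have hpos : 0 < al D + be D := by linarith
  have hN0 : (0 : ℝ) ≤ N := Nat.cast_nonneg N
  have hn1 : n < N + 1 := int_lt_of_mul_lt hpos (by push_cast; nlinarith)
  have hn2 : -(N : ℤ) - 1 < n := int_lt_of_mul_lt hpos (by push_cast; nlinarith)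
  have hn1' : (n : ℝ) ≤ N := by exact_mod_cast Int.lt_add_one_iff.1 hn1
  have hn2' : -(N : ℝ) ≤ n := by exact_mod_cast (by omega : -(N : ℤ) ≤ n)
  have hm1 : m ≤ N' := by
    have : (m : ℝ) ≤ N' := by nlinarith
    exact_mod_cast this
  have hm2 : -(N' : ℤ) ≤ m := by
    have : -(N' : ℝ) ≤ m := by nlinarith
    exact_mod_cast this
  refine ⟨(m, n), ⟨⟨hm2, hm1⟩, by omega, by omega⟩, Subtype.ext ?_⟩
  simpa using hmn.symm

/-! ### Cylinders -/

/-- A bound for the footprint and for its diameter. -/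
noncomputable def size (D : ℕ) : ℝ := 1 + al D + be D

lemma footprint_bounds {D : ℕ} (hD : 1 < D) {P : V} (hP : P ∈ footprint D) :
    (-1 ≤ P.1 ∧ P.1 ≤ be D) ∧ 0 ≤ P.2 ∧ P.2 ≤ al D := by
  obtain ⟨hal, hbe, -⟩ := al_be hD
  obtain ⟨b, hb⟩ := mem_footprint.1 hP
  rw [mem_base] at hb
  cases b <;> simp only [lo, hi, top] at hb <;> exact ⟨⟨by linarith, by linarith⟩, by linarith, by linarith⟩

lemma closure_footprint_norm_le {D : ℕ} (hD : 1 < D) {P : V} (hP : P ∈ closure (footprint D)) :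
    ‖P‖ ≤ size D := by
  have : closure (footprint D) ⊆ Metric.closedBall 0 (size D) := by
    refine closure_minimal (fun Q hQ => ?_) Metric.isClosed_closedBall
    obtain ⟨hal, hbe, -⟩ := al_be hD
    obtain ⟨⟨h1, h2⟩, h3, h4⟩ := footprint_bounds hD hQ
    rw [mem_closedBall_zero_iff, norm_prod_le_iff, Real.norm_eq_abs, Real.norm_eq_abs, abs_le, abs_le]
    unfold size
    exact ⟨⟨by linarith, by linarith⟩, by linarith, by linarith⟩
  exact mem_closedBall_zero_iff.1 (this hP)

variable {D : ℕ} {ε : (OK D)ˣ}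

/-- Inside a letter the forward itinerary depends only on the unstable coordinate. Prepending a
letter pulls `J` back along `y ↦ ε y - c.2`, contracting it by `ε⁻¹`; the Markov crossing keeps it
within the letter, so adjacent admissibility suffices. -/
lemma exists_unstable_side (hD : 1 < D) (hsq : Squarefree D) (hε : IsFundamentalUnit D ε)
    {s : ℤ → Letter D ε} (hs : s ∈ Sigma D ε) (n : ℕ) : ∀ k : ℤ, ∃ J : Set ℝ, J.Nonempty ∧
      (∀ x ∈ J, ∀ y ∈ J, |x - y| ≤ size D * ((unitPt ε).2)⁻¹ ^ n) ∧
      (∀ y ∈ J, ∃ Q ∈ planeRep D (s k), Q.2 = y) ∧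
      ∀ P ∈ planeRep D (s k), (∀ i ≤ n, (phi D ε ^ i) (proj D P) ∈ (s (k + i) : Set (Torus D))) ↔
        P.2 ∈ J := by
  have hu : 1 < (unitPt ε).2 := hε.1
  induction n with
  | zero =>
    intro k
    refine ⟨Prod.snd '' planeRep D (s k), (planeRep_nonempty hD hsq _).image _, ?_, fun y hy => hy,
      fun P hP => ⟨fun _ => mem_image_of_mem _ hP, fun _ i hi => ?_⟩⟩
    · rintro _ ⟨P, hP, rfl⟩ _ ⟨Q, hQ, rfl⟩
      obtain ⟨hal, hbe, -⟩ := al_be hD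
      obtain ⟨-, h1, h2⟩ := footprint_bounds hD hP.2
      obtain ⟨-, h3, h4⟩ := footprint_bounds hD hQ.2
      rw [pow_zero, mul_one, abs_le, size]
      exact ⟨by linarith, by linarith⟩
    · obtain rfl : i = 0 := by omega
      simpa using hP.1
  | succ n ih =>
    intro k
    obtain ⟨c, hc, hstep, hcross⟩ := markov_step hD hsq hε _ _ (hs k)
    obtain ⟨J, ⟨y₀, hy₀⟩, hdiam, hsub, hiff⟩ := ih (k + 1)
    refine ⟨{y | (unitPt ε).2 * y - c.2 ∈ J}, ⟨(y₀ + c.2) / (unitPt ε).2, ?_⟩, ?_, ?_, ?_⟩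
    · rw [mem_ofPred_eq]
      convert hy₀ using 1
      field_simp
      ring
    · intro x hx y hy
      have h := hdiam _ hx _ hy
      rw [sub_sub_sub_cancel_right, ← mul_sub, abs_mul, abs_of_pos (by linarith : 0 < (unitPt ε).2)]
        at h
      rw [pow_succ, ← mul_assoc, ← div_eq_mul_inv, le_div_iff₀ (by linarith)]
      linarith
    · intro y hy
      obtain ⟨Q, hQ, hQy⟩ := hsub _ hy
      obtain ⟨P, hP⟩ := planeRep_nonempty hD hsq (s k)
      refine ⟨_, (hcross P hP Q hQ).2, ?_⟩
      rw [hQy]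
      field_simp
      ring
    · intro P hP
      have hproj : proj D (unitPt ε * P - c) = phi D ε (proj D P) := by rw [proj_sub hc, phi_proj]
      have hpow : ∀ i : ℕ, (phi D ε ^ (i + 1)) (proj D P) =
          (phi D ε ^ i) (proj D (unitPt ε * P - c)) := fun i => by
        rw [hproj, pow_succ, Equiv.Perm.mul_apply]
      have hidx : ∀ i : ℕ, s (k + (i + 1 : ℕ)) = s (k + 1 + i) := fun i => by
        congr 1; push_cast; ring
      constructor
      · intro h
        have h1 : phi D ε (proj D P) ∈ (s (k + 1) : Set (Torus D)) := by
          simpa using h 1 (by omega)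
        refine (hiff _ (hstep P hP h1)).1 fun i hi => ?_
        rw [← hpow, ← hidx]
        exact h (i + 1) (by omega)
      · intro h
        obtain ⟨Q, hQ, hQy⟩ := hsub _ h
        have hmem : unitPt ε * P - c ∈ planeRep D (s (k + 1)) := by
          convert (hcross P hP Q hQ).1 using 1
          ext
          · simp
          · simp [hQy]
        intro i hi
        rcases i with _ | i
        · simpa using hP.1
        · rw [hpow, hidx]
          exact (hiff _ hmem).2 h i (by omega)

/-- The backward counterpart: `H` is pushed forward along `z ↦ conj ε * z - c.1`, and `|conj ε| =
ε⁻¹`. -/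
lemma exists_stable_side (hD : 1 < D) (hsq : Squarefree D) (hε : IsFundamentalUnit D ε)
    {s : ℤ → Letter D ε} (hs : s ∈ Sigma D ε) (n : ℕ) : ∀ k : ℤ, ∃ H : Set ℝ, H.Nonempty ∧
      (∀ x ∈ H, ∀ y ∈ H, |x - y| ≤ size D * ((unitPt ε).2)⁻¹ ^ n) ∧
      (∀ x ∈ H, ∃ Q ∈ planeRep D (s k), Q.1 = x) ∧
      ∀ P ∈ planeRep D (s k),
        (∀ i ≤ n, ((phi D ε)⁻¹ ^ i) (proj D P) ∈ (s (k - i) : Set (Torus D))) ↔ P.1 ∈ H := by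
  have hu : 1 < (unitPt ε).2 := hε.1
  induction n with
  | zero =>
    intro k
    refine ⟨Prod.fst '' planeRep D (s k), (planeRep_nonempty hD hsq _).image _, ?_, fun y hy => hy,
      fun P hP => ⟨fun _ => mem_image_of_mem _ hP, fun _ i hi => ?_⟩⟩
    · rintro _ ⟨P, hP, rfl⟩ _ ⟨Q, hQ, rfl⟩
      obtain ⟨hal, hbe, -⟩ := al_be hD
      obtain ⟨⟨h1, h2⟩, -⟩ := footprint_bounds hD hP.2
      obtain ⟨⟨h3, h4⟩, -⟩ := footprint_bounds hD hQ.2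
      rw [pow_zero, mul_one, abs_le, size]
      exact ⟨by linarith, by linarith⟩
    · obtain rfl : i = 0 := by omega
      simpa using hP.1
  | succ n ih =>
    intro k
    have hk := hs (k - 1)
    rw [sub_add_cancel] at hk
    obtain ⟨c, hc, hstep, hcross⟩ := markov_step hD hsq hε _ _ hk
    obtain ⟨H, hne, hdiam, hsub, hiff⟩ := ih (k - 1)
    have hpow : ∀ (i : ℕ) {P Q : V}, proj D Q = (phi D ε)⁻¹ (proj D P) →
        ((phi D ε)⁻¹ ^ (i + 1)) (proj D P) = ((phi D ε)⁻¹ ^ i) (proj D Q) := fun i P Q h => by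
      rw [h, pow_succ, Equiv.Perm.mul_apply]
    have hidx : ∀ i : ℕ, s (k - (i + 1 : ℕ)) = s (k - 1 - i) := fun i => by
      congr 1; push_cast; ring
    refine ⟨(fun z => (unitPt ε).1 * z - c.1) '' H, hne.image _, ?_, ?_, ?_⟩
    · rintro _ ⟨x, hx, rfl⟩ _ ⟨y, hy, rfl⟩
      have h := hdiam _ hx _ hy
      rw [sub_sub_sub_cancel_right, ← mul_sub, abs_mul, abs_fst_unitPt hD hsq hu, pow_succ,
        ← mul_assoc, mul_comm]
      exact mul_le_mul_of_nonneg_right h (by positivity)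
    · rintro _ ⟨x, hx, rfl⟩
      obtain ⟨Q, hQ, rfl⟩ := hsub _ hx
      obtain ⟨P, hP⟩ := planeRep_nonempty hD hsq (s k)
      exact ⟨_, (hcross Q hQ P hP).1, rfl⟩
    · intro P hP
      constructor
      · intro h
        have h1 : (phi D ε)⁻¹ (proj D P) ∈ (s (k - 1) : Set (Torus D)) := by
          simpa using h 1 (by omega)
        obtain ⟨Q, hQ, hQP⟩ := exists_planeRep hD hsq _ h1
        have hφ : phi D ε (proj D Q) = proj D P := by
          rw [hQP]; exact (phi D ε).apply_symm_apply _
        have h2 := hstep Q hQ (by rw [hφ]; exact hP.1)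
        have h3 : unitPt ε * Q - c = P :=
          footprint_translate hD hsq h2.2 hP.2 (by rw [proj_sub hc, ← phi_proj, hφ])
        refine ⟨Q.1, (hiff Q hQ).1 fun i hi => ?_, ?_⟩
        · rw [← hpow i hQP, ← hidx]
          exact h (i + 1) (by omega)
        · rw [← h3]; simp
      · rintro ⟨z, hz, hzP⟩
        obtain ⟨Q, hQ, rfl⟩ := hsub _ hz
        -- The stable coordinate of `Q` and the pulled-back unstable coordinate of `P` give the lift
        -- of `φ⁻¹` of the point in the previous letter.
        have hmem := (hcross Q hQ P hP).2
        have hQP : proj D (Q.1, (P.2 + c.2) / (unitPt ε).2) = (phi D ε)⁻¹ (proj D P) := by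
          rw [Equiv.Perm.eq_inv_iff_eq, phi_proj, ← proj_sub hc]
          congr 1
          ext
          · simpa using hzP
          · simp only [Prod.snd_sub, Prod.snd_mul]; field_simp; ring
        intro i hi
        rcases i with _ | i
        · simpa using hP.1
        · rw [hpow i hQP, hidx]
          exact (hiff _ hmem).2 hz i (by omega)

lemma mem_wordSet_window {s : ℤ → Letter D ε} {k : ℤ} {n : ℕ} {p : Torus D} :
    p ∈ wordSet (window s k n) ↔
      ∀ i : ℤ, -(n : ℤ) ≤ i → i ≤ n → (phi D ε ^ i) p ∈ (s (k + i) : Set (Torus D)) := by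
  simp only [wordSet, window, mem_iInter, mem_preimage, Subtype.forall, mem_Icc, and_imp]

lemma mem_wordSet_window_iff_nat {s : ℤ → Letter D ε} {k : ℤ} {n : ℕ} {p : Torus D} :
    p ∈ wordSet (window s k n) ↔
      (∀ i ≤ n, (phi D ε ^ i) p ∈ (s (k + i) : Set (Torus D))) ∧
        ∀ i ≤ n, ((phi D ε)⁻¹ ^ i) p ∈ (s (k - i) : Set (Torus D)) := by
  rw [mem_wordSet_window]
  constructor
  · intro h
    refine ⟨fun i hi => ?_, fun i hi => ?_⟩
    · simpa using h i (by omega) (by omega)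
    · have := h (-i) (by omega) (by omega)
      rwa [zpow_neg, zpow_natCast, ← inv_pow, ← sub_eq_add_neg] at this
  · rintro ⟨h1, h2⟩ i hi0 hi1
    obtain ⟨j, rfl | rfl⟩ := i.eq_nat_or_neg
    · simpa using h1 j (by omega)
    · rw [zpow_neg, zpow_natCast, ← inv_pow, ← sub_eq_add_neg]
      exact h2 j (by omega)

lemma wordSet_window_subset {s : ℤ → Letter D ε} {k : ℤ} {n : ℕ} :
    wordSet (window s k n) ⊆ (s k : Set (Torus D)) := fun p hp => by
  simpa using mem_wordSet_window.1 hp 0 (by omega) (by omega)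

lemma exists_planeRep_wordSet (hD : 1 < D) (hsq : Squarefree D) {s : ℤ → Letter D ε} {k : ℤ}
    {n : ℕ} : proj D '' planeRep D (wordSet (window s k n)) = wordSet (window s k n) := by
  refine Subset.antisymm (by rintro _ ⟨P, hP, rfl⟩; exact hP.1) fun p hp => ?_
  obtain ⟨P, hP, rfl⟩ := exists_planeRep hD hsq _ (wordSet_window_subset hp)
  exact ⟨P, ⟨hp, hP.2⟩, rfl⟩

/-- The planar representatives of cylinders are nonempty and exponentially small. -/
lemma cylinder_nonempty_and_small (hD : 1 < D) (hsq : Squarefree D) (hε : IsFundamentalUnit D ε)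
    {s : ℤ → Letter D ε} (hs : s ∈ Sigma D ε) (k : ℤ) (n : ℕ) :
    (planeRep D (wordSet (window s k n))).Nonempty ∧
      ∀ P ∈ planeRep D (wordSet (window s k n)), ∀ Q ∈ planeRep D (wordSet (window s k n)),
        dist P Q ≤ size D * ((unitPt ε).2)⁻¹ ^ n := by
  obtain ⟨J, ⟨y, hy⟩, hJd, hJs, hJ⟩ := exists_unstable_side hD hsq hε hs n k
  obtain ⟨H, ⟨x, hx⟩, hHd, hHs, hH⟩ := exists_stable_side hD hsq hε hs n k
  -- Within the letter the cylinder is cut out by `H × J`, so both claims are coordinatewise.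
  have hmem : ∀ P ∈ planeRep D (s k), P ∈ planeRep D (wordSet (window s k n)) ↔
      P.1 ∈ H ∧ P.2 ∈ J := fun P hP => by
    rw [← hJ P hP, ← hH P hP, and_comm, ← mem_wordSet_window_iff_nat]
    exact ⟨fun h => h.1, fun h => ⟨h, hP.2⟩⟩
  have hsub : planeRep D (wordSet (window s k n)) ⊆ planeRep D (s k) :=
    fun P hP => ⟨wordSet_window_subset hP.1, hP.2⟩
  constructor
  · obtain ⟨P, hP, rfl⟩ := hHs x hx
    obtain ⟨Q, hQ, rfl⟩ := hJs y hy
    exact ⟨_, (hmem _ (planeRep_prod hD hsq _ hP hQ)).2 ⟨hx, hy⟩⟩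
  · intro P hP Q hQ
    have hP' := (hmem P (hsub hP)).1 hP
    have hQ' := (hmem Q (hsub hQ)).1 hQ
    exact max_le (hHd _ hP'.1 _ hQ'.1) (hJd _ hP'.2 _ hQ'.2)

lemma dist_le_of_mem_closure {S : Set V} {r : ℝ} (h : ∀ P ∈ S, ∀ Q ∈ S, dist P Q ≤ r) :
    ∀ P ∈ closure S, ∀ Q ∈ closure S, dist P Q ≤ r := by
  have h1 : ∀ Q ∈ S, ∀ P ∈ closure S, dist P Q ≤ r := fun Q hQ =>
    closure_minimal (fun P hP => h P hP Q hQ) (Metric.isClosed_closedBall (x := Q) (ε := r))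
  intro P hP
  have h2 : closure S ⊆ Metric.closedBall P r :=
    closure_minimal (fun Q hQ => Metric.mem_closedBall'.2 (h1 Q hQ P hP))
      Metric.isClosed_closedBall
  exact fun Q hQ => Metric.mem_closedBall'.1 (h2 hQ)

lemma closure_planeRep_bounded (hD : 1 < D) {A : Set (Torus D)} {P : V}
    (hP : P ∈ closure (planeRep D A)) : ‖P‖ ≤ size D :=
  closure_footprint_norm_le hD (closure_mono inter_subset_right hP)

lemma isCompact_closure_planeRep (hD : 1 < D) (A : Set (Torus D)) :
    IsCompact (closure (planeRep D A)) :=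
  (isCompact_closedBall (0 : V) (size D)).of_isClosed_subset isClosed_closure
    fun _ hP => mem_closedBall_zero_iff.2 (closure_planeRep_bounded hD hP)

/-- The planar closure is compact, so its image in the Hausdorff torus is closed. -/
lemma closure_wordSet (hD : 1 < D) (hsq : Squarefree D) {s : ℤ → Letter D ε} {k : ℤ}
    {n : ℕ} : closure (wordSet (window s k n)) =
      proj D '' closure (planeRep D (wordSet (window s k n))) := by
  have := t2Space_torus hD hsq
  refine Subset.antisymm ?_ ?_
  · refine closure_minimal ?_
      ((isCompact_closure_planeRep hD _).image (continuous_proj D)).isClosed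
    rw [← exists_planeRep_wordSet hD hsq]
    exact image_mono (by rw [exists_planeRep_wordSet hD hsq]; exact subset_closure)
  · refine (image_closure_subset_closure_image (continuous_proj D)).trans ?_
    rw [exists_planeRep_wordSet hD hsq]

/-! ### The coding map -/

lemma tendsto_size_pow (hε : IsFundamentalUnit D ε) :
    Tendsto (fun n : ℕ => size D * ((unitPt ε).2)⁻¹ ^ n) atTop (𝓝 0) := by
  have hu : 1 < (unitPt ε).2 := hε.1
  simpa using (tendsto_pow_atTop_nhds_zero_of_lt_one (by positivity)
    (inv_lt_one_of_one_lt₀ hu)).const_mul (size D)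

/-- Existence is compactness of nested closures. For uniqueness, lifts of `p` in the shrinking
closures converge to `P`. -/
lemma exists_planar_point (hD : 1 < D) (hsq : Squarefree D) (hε : IsFundamentalUnit D ε)
    {s : ℤ → Letter D ε} (hs : s ∈ Sigma D ε) (k : ℤ) :
    ∃ P : V, (∀ n, P ∈ closure (planeRep D (wordSet (window s k n)))) ∧
      ∀ p : Torus D, (∀ n, p ∈ closure (wordSet (window s k n))) → p = proj D P := by
  have := t2Space_torus hD hsq
  obtain ⟨P, hP⟩ := IsCompact.nonempty_iInter_of_sequence_nonempty_isCompact_isClosed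
    (fun n => closure (planeRep D (wordSet (window s k n))))
    (fun n => closure_mono fun P hP => ⟨mem_wordSet_window.2 fun i h1 h2 =>
      mem_wordSet_window.1 hP.1 i (by push_cast; omega) (by push_cast; omega), hP.2⟩)
    (fun n => (cylinder_nonempty_and_small hD hsq hε hs k n).1.closure)
    (isCompact_closure_planeRep hD _) (fun n => isClosed_closure)
  rw [mem_iInter] at hP
  refine ⟨P, hP, fun p hp => ?_⟩
  have hq : ∀ n, ∃ Q ∈ closure (planeRep D (wordSet (window s k n))), proj D Q = p := fun n => by
    have := hp n
    rwa [closure_wordSet hD hsq] at this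
  choose Q hQ hQp using hq
  have hlim : Tendsto Q atTop (𝓝 P) := by
    rw [tendsto_iff_dist_tendsto_zero]
    exact squeeze_zero (fun _ => dist_nonneg) (fun n =>
      dist_le_of_mem_closure (cylinder_nonempty_and_small hD hsq hε hs k n).2 _ (hQ n) _ (hP n))
      (tendsto_size_pow hε)
  have h1 := ((continuous_proj D).tendsto P).comp hlim
  refine tendsto_nhds_unique (f := fun _ : ℕ => p) tendsto_const_nhds (h1.congr hQp)

lemma exists_isCoded (hD : 1 < D) (hsq : Squarefree D) (hε : IsFundamentalUnit D ε)
    {s : ℤ → Letter D ε} (hs : s ∈ Sigma D ε) : ∃ p, IsCoded s p := by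
  obtain ⟨P, hP, huniq⟩ := exists_planar_point hD hsq hε hs 0
  refine ⟨proj D P, Subset.antisymm (fun p hp => huniq p (mem_iInter.1 hp)) ?_⟩
  rw [singleton_subset_iff, mem_iInter]
  intro n
  rw [closure_wordSet hD hsq]
  exact mem_image_of_mem _ (hP n)

lemma zpow_mem_wordSet_window {s : ℤ → Letter D ε} {k : ℤ} {n : ℕ} {p : Torus D}
    (hp : p ∈ wordSet (window s 0 (n + k.natAbs))) :
    (phi D ε ^ k) p ∈ wordSet (window s k n) := by
  rw [mem_wordSet_window] at hp ⊢
  intro i h1 h2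
  have := hp (i + k) (by omega) (by omega)
  rwa [zpow_add, Equiv.Perm.mul_apply, zero_add, add_comm i k] at this

/-- The shifted strings code the iterates of the coded point, with compatible planar points. -/
lemma IsCoded.exists_planar_point_shift (hD : 1 < D) (hsq : Squarefree D)
    (hε : IsFundamentalUnit D ε) {s : ℤ → Letter D ε} (hs : s ∈ Sigma D ε) {p : Torus D}
    (hp : IsCoded s p) (k : ℤ) :
    ∃ P : V, proj D P = (phi D ε ^ k) p ∧
      ∀ n, P ∈ closure (planeRep D (wordSet (window s k n))) := by
  obtain ⟨P, hP, huniq⟩ := exists_planar_point hD hsq hε hs k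
  refine ⟨P, (huniq _ fun n => ?_).symm, hP⟩
  -- Widening the window by `|k|` leaves radius `n` around the new centre `k`.
  have h1 : p ∈ closure (wordSet (window s 0 (n + k.natAbs))) := by
    have : p ∈ ⋂ n : ℕ, closure (wordSet (window s 0 n)) := by rw [hp]; rfl
    exact mem_iInter.1 this _
  have hcont : Continuous (phi D ε ^ k) := by rw [phi_zpow]; exact continuous_phi _
  exact map_mem_closure hcont h1 fun q hq => zpow_mem_wordSet_window hq

/-! ### The minimum function -/

lemma absNorm_nonneg (P : V) : 0 ≤ absNorm P := abs_nonneg _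

lemma M_proj (D : ℕ) (P : V) : M D (proj D P) = planeM D P := rfl

lemma planeM_le (D : ℕ) (P : V) (Q : OK D) : planeM D P ≤ absNorm (P - embed D Q) :=
  ciInf_le ⟨0, by rintro _ ⟨Q, rfl⟩; exact absNorm_nonneg _⟩ Q

lemma planeM_unitPt_mul_le {D : ℕ} (hD : 1 < D) (hsq : Squarefree D) (v : (OK D)ˣ) (P : V) :
    planeM D (unitPt v * P) ≤ planeM D P := by
  refine le_ciInf fun Q => ?_
  rw [← absNorm_unitPt_mul hD hsq v, mul_sub]
  have h : unitPt v * embed D Q = embed D ((v : OK D) * Q : OK D) := by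
    rw [MulMemClass.coe_mul, map_mul]; rfl
  rw [h]
  exact planeM_le D _ _

lemma M_phi {D : ℕ} (hD : 1 < D) (hsq : Squarefree D) (v : (OK D)ˣ) (p : Torus D) :
    M D (phi D v p) = M D p := by
  obtain ⟨P, rfl⟩ := exists_proj_eq p
  rw [phi_proj, M_proj, M_proj]
  refine le_antisymm (planeM_unitPt_mul_le hD hsq v P) ?_
  simpa only [unitPt_inv_mul] using planeM_unitPt_mul_le hD hsq v⁻¹ (unitPt v * P)

lemma absNorm_le_of_norm_le {P : V} {R : ℝ} (h : ‖P‖ ≤ R) : absNorm P ≤ R ^ 2 := by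
  rw [absNorm, abs_mul, sq]
  have h1 := (norm_fst_le P).trans h
  have h2 := (norm_snd_le P).trans h
  exact mul_le_mul h1 h2 (abs_nonneg _) ((abs_nonneg _).trans h1)

lemma absNorm_le_of_dist_le {P Q : V} {R δ : ℝ} (h : dist P Q ≤ δ) (hQ : ‖Q‖ ≤ R) :
    absNorm P ≤ absNorm Q + δ * (2 * R + δ) := by
  rw [dist_eq_norm] at h
  have h1 : |P.1 - Q.1| ≤ δ := (norm_fst_le (P - Q)).trans h
  have h2 : |P.2 - Q.2| ≤ δ := (norm_snd_le (P - Q)).trans h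
  have h3 : |Q.1| ≤ R := (norm_fst_le Q).trans hQ
  have h4 : |Q.2| ≤ R := (norm_snd_le Q).trans hQ
  have hδ : 0 ≤ δ := (abs_nonneg _).trans h1
  have e : P.1 * P.2 = Q.1 * Q.2 +
      ((P.1 - Q.1) * (P.2 - Q.2) + (P.1 - Q.1) * Q.2 + (P.2 - Q.2) * Q.1) := by ring
  unfold absNorm
  rw [e]
  refine (abs_add_le _ _).trans (add_le_add le_rfl ?_)
  refine (abs_add_three _ _ _).trans ?_
  rw [abs_mul, abs_mul, abs_mul]
  have m1 := mul_le_mul h1 h2 (abs_nonneg _) hδ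
  have m2 := mul_le_mul h1 h4 (abs_nonneg _) hδ
  have m3 := mul_le_mul h2 h3 (abs_nonneg _) hδ
  linarith

/-! ### Balancing the two coordinates by a unit -/

/-- If `e^m ≤ y < e^(m+1)`, then `k = -(m+1)` gives `e^k y < 1` and `e^(m+1) x ≤ e x y ≤ C e`. If `y
= 0`, a large power shrinks `x`. -/
lemma exists_zpow_balance {x y C e : ℝ} (hx : 0 ≤ x) (hy : 0 ≤ y) (hC : 0 ≤ C) (hxy : x * y ≤ C)
    (he : 1 < e) : ∃ k : ℤ, (e ^ k)⁻¹ * x ≤ C * e + 1 ∧ e ^ k * y ≤ C * e + 1 := by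
  have he0 : 0 < e := by linarith
  have hCe : 0 ≤ C * e := by positivity
  rcases hy.eq_or_lt with rfl | hy
  · obtain ⟨n, hn⟩ := pow_unbounded_of_one_lt x he
    refine ⟨n, ?_, by rw [mul_zero]; linarith⟩
    rw [zpow_natCast, inv_mul_le_iff₀ (by positivity)]
    nlinarith [pow_pos he0 n]
  · obtain ⟨m, hm1, hm2⟩ := exists_mem_Ico_zpow hy he
    have hp : 0 < e ^ (m + 1) := zpow_pos he0 _
    refine ⟨-(m + 1), ?_, ?_⟩
    · rw [zpow_neg, inv_inv, zpow_add_one₀ he0.ne']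
      have := mul_le_mul_of_nonneg_right hm1 hx
      nlinarith
    · rw [zpow_neg, inv_mul_le_iff₀ hp]
      nlinarith

lemma unitPt_zpow_snd {D : ℕ} (ε : (OK D)ˣ) (k : ℤ) : (unitPt (ε ^ k)).2 = (unitPt ε).2 ^ k := by
  have hnat : ∀ n : ℕ, (unitPt (ε ^ n)).2 = (unitPt ε).2 ^ n := fun n => by simp [unitPt]
  obtain ⟨n, rfl | rfl⟩ := k.eq_nat_or_neg
  · rw [zpow_natCast, zpow_natCast, hnat]
  · rw [zpow_neg, zpow_neg, zpow_natCast, zpow_natCast, ← hnat]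
    have h : unitPt (ε ^ n)⁻¹ * unitPt (ε ^ n) = 1 := by
      rw [← unitPt_mul, inv_mul_cancel, unitPt_one]
    exact eq_inv_of_mul_eq_one_left (congrArg Prod.snd h)

lemma exists_unit_balance {D : ℕ} (hD : 1 < D) (hsq : Squarefree D) {ε : (OK D)ˣ}
    (hε : 1 < (unitPt ε).2) {P : V} {C : ℝ} (h : absNorm P ≤ C) :
    ∃ k : ℤ, ‖unitPt (ε ^ k) * P‖ ≤ C * (unitPt ε).2 + 1 := by
  rw [absNorm, abs_mul] at h
  obtain ⟨k, h1, h2⟩ := exists_zpow_balance (abs_nonneg P.1) (abs_nonneg P.2)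
    ((by positivity : 0 ≤ |P.1| * |P.2|).trans h) h hε
  have hpos : 0 < (unitPt ε).2 ^ k := zpow_pos (by linarith) k
  have hfst : |(unitPt (ε ^ k)).1| = ((unitPt ε).2 ^ k)⁻¹ := by
    have := abs_norm_unitPt hD hsq (ε ^ k)
    rw [abs_mul, unitPt_zpow_snd, abs_of_pos hpos] at this
    exact eq_inv_of_mul_eq_one_left this
  refine ⟨k, norm_prod_le_iff.2 ⟨?_, ?_⟩⟩
  · rw [Prod.fst_mul, norm_mul, Real.norm_eq_abs, Real.norm_eq_abs, hfst]
    exact h1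
  · rw [Prod.snd_mul, norm_mul, Real.norm_eq_abs, Real.norm_eq_abs, unitPt_zpow_snd,
      abs_of_pos hpos]
    exact h2

/-! ### The two inclusions -/

lemma piPreimage_subset_sigmaAvoid (hD : 1 < D) (hsq : Squarefree D) (hε : IsFundamentalUnit D ε)
    (n : ℕ) (t : ℝ) (I : Finset (OK D)) :
    piPreimage D ε (X D t) ⊆ sigmaAvoid D ε n (T D ε n t I) := by
  rintro s ⟨hs, p, hp, hcod⟩
  refine ⟨hs, ?_⟩
  rintro w hw k rfl
  obtain ⟨P, hPp, hP⟩ := hcod.exists_planar_point_shift hD hsq hε hs k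
  have hU := hw.2 (hP n)
  simp only [U, mem_iUnion, mem_ofPred_eq] at hU
  obtain ⟨Q, -, hQ⟩ := hU
  have h1 : M D p ≤ absNorm (P - embed D Q) := by
    rw [← M_phi hD hsq (ε ^ k) p, ← phi_zpow, ← hPp, M_proj]
    exact planeM_le D P Q
  have hp' : t ≤ M D p := hp
  linarith

/-- A bound for the balanced difference between a point and a lattice point. -/
noncomputable def balanceBound (ε : (OK D)ˣ) : ℝ := (size D ^ 2 + 1) * (unitPt ε).2 + 1

/-- If `M` is less than `t` at the coded point, this is witnessed at some iterate by an integer of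
bounded size. -/
lemma exists_bounded_witness (hD : 1 < D) (hsq : Squarefree D) (hε : IsFundamentalUnit D ε)
    {s : ℤ → Letter D ε} (hs : s ∈ Sigma D ε) {p : Torus D} (hp : IsCoded s p) {t : ℝ}
    (ht : M D p < t) :
    ∃ (k : ℤ) (P : V) (Q : OK D), (∀ n, P ∈ closure (planeRep D (wordSet (window s k n)))) ∧
      absNorm (P - embed D Q) < t ∧ ‖P - embed D Q‖ ≤ balanceBound ε ∧
      ‖embed D Q‖ ≤ size D + balanceBound ε := by
  obtain ⟨P₀, hP₀p, hP₀⟩ := hp.exists_planar_point_shift hD hsq hε hs 0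
  rw [zpow_zero, Equiv.Perm.one_apply] at hP₀p
  -- `Q = 0` shows `M ≤ size²`. Capping at `size² + 1` bounds the witness independently of `t`, so
  -- one `I_K` serves every `t`.
  have hM : planeM D P₀ < min t (size D ^ 2 + 1) := by
    refine lt_min (by rwa [← M_proj, hP₀p]) ?_
    have h1 := planeM_le D P₀ 0
    rw [ZeroMemClass.coe_zero, map_zero, sub_zero] at h1
    have h2 := absNorm_le_of_norm_le (closure_planeRep_bounded hD (hP₀ 0))
    linarith
  obtain ⟨Q, hQ⟩ := exists_lt_of_ciInf_lt hM
  obtain ⟨k, hk⟩ := exists_unit_balance hD hsq hε.1 (hQ.le.trans (min_le_right _ _))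
  obtain ⟨P, hPp, hP⟩ := hp.exists_planar_point_shift hD hsq hε hs k
  rw [← hP₀p, phi_zpow_proj] at hPp
  obtain ⟨q, hq, hqd⟩ := proj_eq_proj.1 hPp
  have hqd : embed D q = unitPt (ε ^ k) * P₀ - P := hqd
  -- Subtracting `q`, the translation from `P` to `ε^k P₀`, keeps the difference equal to `ε^k (P₀ -
  -- Q)`.
  refine ⟨k, P, ((ε ^ k : (OK D)ˣ) : OK D) * Q - ⟨q, hq⟩, hP, ?_⟩
  have he : P - embed D (((ε ^ k : (OK D)ˣ) : OK D) * Q - ⟨q, hq⟩ : OK D) =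
      unitPt (ε ^ k) * (P₀ - embed D Q) := by
    rw [AddSubgroupClass.coe_sub, map_sub, hqd, MulMemClass.coe_mul, map_mul, mul_sub]
    change P - (unitPt (ε ^ k) * _ - _) = _
    abel
  refine ⟨?_, ?_, ?_⟩
  · rw [he, absNorm_unitPt_mul hD hsq]
    exact hQ.trans_le (min_le_left _ _)
  · rw [he]; exact hk
  · rw [← sub_sub_cancel P (embed D _)]
    refine (norm_sub_le _ _).trans (add_le_add (closure_planeRep_bounded hD (hP 0)) ?_)
    rw [he]; exact hk

/-- The bound on `P - Q` in `exists_bounded_witness` does not depend on `s`, so one `n` makes the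
variation of `𝐍` over every relevant cylinder less than `t - t'`. -/
lemma sigmaAvoid_subset_piPreimage (hD : 1 < D) (hsq : Squarefree D) (hε : IsFundamentalUnit D ε)
    {I : Finset (OK D)} (hI : ∀ Q : OK D, ‖embed D Q‖ ≤ size D + balanceBound ε → Q ∈ I)
    {t' t : ℝ} (htt : t' < t) :
    ∀ᶠ n : ℕ in atTop, sigmaAvoid D ε n (T D ε n t I) ⊆ piPreimage D ε (X D t') := by
  have hlim : Tendsto (fun n : ℕ => (size D * ((unitPt ε).2)⁻¹ ^ n) *
      (2 * balanceBound ε + size D * ((unitPt ε).2)⁻¹ ^ n)) atTop (𝓝 0) := by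
    have h := tendsto_size_pow hε
    simpa using h.mul (h.const_add (2 * balanceBound ε))
  filter_upwards [hlim.eventually_lt_const (sub_pos.2 htt)] with n hn
  rintro s ⟨hs, havoid⟩
  obtain ⟨p, hp⟩ := exists_isCoded hD hsq hε hs
  refine ⟨hs, p, ?_, hp⟩
  by_contra hcon
  obtain ⟨k, P, Q, hP, hQt, hQ1, hQ2⟩ :=
    exists_bounded_witness hD hsq hε hs hp (lt_of_not_ge hcon)
  obtain ⟨hne, hsmall⟩ := cylinder_nonempty_and_small hD hsq hε hs k n
  refine havoid (window s k n) ⟨⟨?_, _, rfl⟩, fun Y hY => ?_⟩ k rfl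
  · obtain ⟨Y, hY⟩ := hne
    exact ⟨_, hY.1⟩
  · have hd := dist_le_of_mem_closure hsmall Y hY P (hP n)
    rw [← dist_sub_right _ _ (embed D Q)] at hd
    have := absNorm_le_of_dist_le hd hQ1
    refine mem_iUnion₂.2 ⟨Q, hI Q hQ2, ?_⟩
    change absNorm _ < t
    linarith

lemma IsCoded.unique {s : ℤ → Letter D ε} {p q : Torus D} (hp : IsCoded s p) (hq : IsCoded s q) :
    p = q := singleton_injective (hp.symm.trans hq)

end RealQuadraticTorus

theorem proposition2 (D : ℕ) (hD : 1 < D) (hsq : Squarefree D)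
    (ε : (RealQuadraticTorus.OK D)ˣ) (hε : RealQuadraticTorus.IsFundamentalUnit D ε) :
    ∃ I_K : Finset (RealQuadraticTorus.OK D), ∀ I : Finset (RealQuadraticTorus.OK D), I_K ⊆ I →
      (∀ t' t : ℝ, t' < t → ∀ᶠ n : ℕ in atTop,
        RealQuadraticTorus.piPreimage D ε (RealQuadraticTorus.X D t) ⊆
            RealQuadraticTorus.sigmaAvoid D ε n (RealQuadraticTorus.T D ε n t I) ∧
          RealQuadraticTorus.sigmaAvoid D ε n (RealQuadraticTorus.T D ε n t I) ⊆
            RealQuadraticTorus.piPreimage D ε (RealQuadraticTorus.X D t')) ∧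
      (∀ t : ℝ, RealQuadraticTorus.piPreimage D ε (RealQuadraticTorus.X D t) =
        ⋂ n : ℕ, RealQuadraticTorus.sigmaAvoid D ε n (RealQuadraticTorus.T D ε n t I)) := by
  open RealQuadraticTorus in
  refine ⟨(finite_bounded_integers hD hsq (size D + balanceBound ε)).toFinset, fun I hI => ?_⟩
  have hI' : ∀ Q : OK D, ‖embed D Q‖ ≤ size D + balanceBound ε → Q ∈ I := fun Q hQ =>
    hI (by simpa using hQ)
  refine ⟨fun t' t htt => ?_, fun t => Subset.antisymm
    (subset_iInter fun n => piPreimage_subset_sigmaAvoid hD hsq hε n t I) fun s hs => ?_⟩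
  · filter_upwards [sigmaAvoid_subset_piPreimage hD hsq hε hI' htt] with n hn
    exact ⟨piPreimage_subset_sigmaAvoid hD hsq hε n t I, hn⟩
  · rw [mem_iInter] at hs
    have hsig := (hs 0).1
    obtain ⟨p, hp⟩ := exists_isCoded hD hsq hε hsig
    refine ⟨hsig, p, show t ≤ M D p from le_of_forall_lt fun t' ht' => ?_, hp⟩
    -- The inclusion for `r < t` yields only `r ≤ M`; taking `r > t'` makes the bound strict.
    obtain ⟨r, hr, hrt⟩ := exists_between ht'
    obtain ⟨n, hn⟩ := (sigmaAvoid_subset_piPreimage hD hsq hε hI' hrt).exists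
    obtain ⟨-, q, hq, hq'⟩ := hn (hs n)
    rw [hp.unique hq']
    exact hr.trans_le hq
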